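/- Let $X$ be an infinite set and let $H\le G$ be permutation groups on $X$, both closed in $\mathrm{Sym}(X)$ in the topology of pointwise convergence (with $X$ discrete). Suppose that $G$ is primitive but not $2$-transitive on $X$. Let $n\in\mathbb N$, and suppose that, for each $l\le n+2^{\,n^2-n+2}-2$, $G$ and $H$ have the same orbits on the set $X^{[l]}$ of $l$-element subsets of $X$. Then, for each $m\le n$, $G$ and $H$ have the same orbits on the set $X^m$ of $m$-tuples of elements of $X$. -/

import Mathlib

/-- The topology of pointwise convergence on `Sym(X)`, where `X` carries the discrete topology:
the subspace topology that `Sym(X)` inherits from the product space `X → X`. -/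
abbrev permTopology (X : Type*) : TopologicalSpace (Equiv.Perm X) :=
  TopologicalSpace.induced (fun (g : Equiv.Perm X) (x : X) => g x)
    (@Pi.topologicalSpace X (fun _ => X) (fun _ => ⊥))

/-- A closed permutation group on `X`: a subgroup of `Sym(X)` which is closed in `Sym(X)` in the
topology of pointwise convergence. -/
def IsClosedPermGroup {X : Type*} (G : Subgroup (Equiv.Perm X)) : Prop :=
  @IsClosed _ (permTopology X) (G : Set (Equiv.Perm X))

/-- The permutation groups `G` and `H` on `X` have the same orbits on the set `Y`, on which
`Sym(X)` acts. -/
def HaveSameOrbitsOn {X : Type*} (G H : Subgroup (Equiv.Perm X)) (Y : Type*)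
    [MulAction (Equiv.Perm X) Y] : Prop :=
  ∀ y : Y, MulAction.orbit G y = MulAction.orbit H y

/-! It suffices to put each finite `F` in a finite `A`, of bounded size, such that every element of
`G` stabilizing `A` fixes `F` pointwise (`IsRigidExtension`). If `g` moves a tuple with entries in
`F`, the hypothesis on sets gives `h` in `H` with `hA = gA`; then `h⁻¹g` stabilizes `A`, fixes `F`,
and `h` moves the tuple as `g` does.

Failure of 2-transitivity gives an invariant tournament, or an invariant graph that is neither empty
nor complete, with a single orbit of arcs up to reversal. A nonprincipal ultrafilter `U` supplies
generic points to add to `F`, and a point of `F` sees them according to its membership in `relLimit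
R U`. By primitivity a class of ultrafilters closed under `G` separates all pairs of points or none,
and `|F| - 1` separating ultrafilters suffice for `F`.

In a tournament, long generic chains are rigid and can be peeled off one at a time
(`IsTournamentRel.chain_fixed`). In a graph, the ultrafilters are split by whether their generic
sequences are cliques or independent sets. If one type separates points, blocks of twins of sizes 2,
4, 8, ... are added, and the number of added neighbours of a point of `F` encodes in binary which
blocks it sees (`IsBlockSequence.fixed`). The points of `F` must not pass for block members, which
is arranged by `exists_separating_not_limit`. If neither type separates, the graph or its complement
is locally finite and connected, and faraway points are added, seen through the distance. -/

open Filter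
open scoped Pointwise

/-! ### Invariant relations and the reduction to rigid extensions -/

/-- A relation is invariant under a permutation group. -/
def IsInvariantRel {X : Type*} (G : Subgroup (Equiv.Perm X)) (r : X → X → Prop) : Prop :=
  ∀ g ∈ G, ∀ x y, r (g x) (g y) ↔ r x y

theorem IsInvariantRel.of_imp {X : Type*} {G : Subgroup (Equiv.Perm X)} {r : X → X → Prop}
    (h : ∀ g ∈ G, ∀ x y, r x y → r (g x) (g y)) : IsInvariantRel G r := by
  intro g hg x y
  refine ⟨fun hr => ?_, h g hg x y⟩
  simpa using h g⁻¹ (G.inv_mem hg) _ _ hr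

/-- An invariant equivalence relation of a primitive permutation group is trivial or universal. -/
theorem eq_or_forall_of_isPreprimitive {X : Type*} {G : Subgroup (Equiv.Perm X)}
    (hprim : MulAction.IsPreprimitive G X) {r : X → X → Prop} (hr : Equivalence r)
    (hinv : IsInvariantRel G r) : (∀ x y, r x y → x = y) ∨ (∀ x y, r x y) := by
  have hmem : ∀ (g : G) (x y : X), y ∈ g • {z | r x z} ↔ r (g • x) y := by
    intro g x y
    rw [Set.mem_smul_set_iff_inv_smul_mem, Set.mem_ofPred_eq]
    have := hinv g g.2 x (g⁻¹ • y)
    rw [← this]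
    change r (g • x) (g • g⁻¹ • y) ↔ _
    rw [smul_inv_smul]
  have hblock : ∀ x, MulAction.IsBlock G {z | r x z} := by
    intro x
    rw [MulAction.isBlock_iff_smul_eq_or_disjoint]
    intro g
    by_cases hd : Disjoint (g • {z | r x z}) {z | r x z}
    · exact Or.inr hd
    · left
      rw [Set.not_disjoint_iff] at hd
      obtain ⟨w, hw, hw'⟩ := hd
      rw [hmem] at hw
      ext y
      rw [hmem]
      exact ⟨fun h => hr.trans hw' (hr.trans (hr.symm hw) h),
        fun h => hr.trans hw (hr.trans (hr.symm hw') h)⟩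
  by_cases h : ∃ x, {z | r x z} = Set.univ
  · right
    obtain ⟨x, hx⟩ := h
    have hx' : ∀ y, r x y := fun y => by
      have : y ∈ {z | r x z} := hx ▸ Set.mem_univ y
      exact this
    exact fun y z => hr.trans (hr.symm (hx' y)) (hx' z)
  · left
    intro x y hxy
    rcases hprim.isTrivialBlock_of_isBlock (hblock x) with h1 | h1
    · exact h1 (hr.refl x) hxy
    · exact absurd ⟨x, h1⟩ h

/-- `A` witnesses the rigidity of `F`: it is not too large, and each element of `G` which
stabilizes `A` fixes `F` pointwise. -/
def IsRigidExtension {X : Type*} (G : Subgroup (Equiv.Perm X)) (F A : Finset X) : Prop :=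
  F ⊆ A ∧ A.card + 2 ≤ F.card + 2 ^ (F.card ^ 2 - F.card + 2) ∧
    ∀ g ∈ G, (∀ x, g x ∈ A ↔ x ∈ A) → ∀ x ∈ F, g x = x

theorem sq_sub_self_mono {a b : ℕ} (h : a ≤ b) : a ^ 2 - a ≤ b ^ 2 - b := by
  have e : ∀ n : ℕ, n ^ 2 - n = n * (n - 1) := fun n => by rw [Nat.mul_sub, sq, mul_one]
  rw [e, e]
  exact Nat.mul_le_mul h (Nat.sub_le_sub_right h 1)

theorem haveSameOrbitsOn_tuples {X : Type*} [DecidableEq X] {G H : Subgroup (Equiv.Perm X)}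
    (hHG : H ≤ G) (hrigid : ∀ F : Finset X, ∃ A, IsRigidExtension G F A) (n : ℕ)
    (hsets : ∀ l : ℕ, l ≤ n + 2 ^ (n ^ 2 - n + 2) - 2 →
      HaveSameOrbitsOn G H (Set.powersetCard X l)) :
    ∀ m : ℕ, m ≤ n → HaveSameOrbitsOn G H (Fin m → X) := by
  intro m hm y
  apply Set.Subset.antisymm
  · rintro _ ⟨g, rfl⟩
    obtain ⟨A, hFA, hA, hfix⟩ := hrigid (Finset.univ.image y)
    have hcard : (Finset.univ.image y).card ≤ n :=
      (Finset.card_image_le.trans (by simp)).trans hm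
    have hAl : A.card ≤ n + 2 ^ (n ^ 2 - n + 2) - 2 := by
      have := Nat.pow_le_pow_right (n := 2) (by norm_num)
        (Nat.add_le_add_right (sq_sub_self_mono hcard) 2)
      omega
    have horb := hsets A.card hAl ⟨A, rfl⟩
    have hg : g • (⟨A, rfl⟩ : Set.powersetCard X A.card) ∈
        MulAction.orbit H (⟨A, rfl⟩ : Set.powersetCard X A.card) :=
      horb ▸ MulAction.mem_orbit _ g
    obtain ⟨h, hh⟩ := hg
    have hh' : (h : Equiv.Perm X) • A = (g : Equiv.Perm X) • A :=
      congrArg (fun s : Set.powersetCard X A.card => (s : Finset X)) hh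
    have hk : ∀ x, ((h : Equiv.Perm X)⁻¹ * g) x ∈ A ↔ x ∈ A := by
      intro x
      rw [Equiv.Perm.mul_apply]
      have h1 : (h : Equiv.Perm X)⁻¹ ((g : Equiv.Perm X) x) ∈ A ↔
          (g : Equiv.Perm X) x ∈ (h : Equiv.Perm X) • A := by
        rw [Finset.mem_smul_finset]
        constructor
        · exact fun hx => ⟨_, hx, by simp⟩
        · rintro ⟨z, hz, hzx⟩
          rw [← hzx]
          simpa using hz
      rw [h1, hh']
      exact Finset.smul_mem_smul_finset_iff _
    refine ⟨h, ?_⟩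
    funext i
    have := hfix _ (G.mul_mem (G.inv_mem (hHG h.2)) g.2) hk (y i) (by simp)
    rw [Equiv.Perm.mul_apply, Equiv.Perm.inv_eq_iff_eq] at this
    exact this.symm
  · rintro _ ⟨h, rfl⟩
    exact ⟨⟨h.1, hHG h.2⟩, rfl⟩

/-! ### Separating families and peelable relations -/

/-- Finitely many points that are separated by a family of equivalence relations are separated by
a subfamily which has fewer members than there are points. -/
theorem exists_separating_list {X ι : Type*} {r : ι → X → X → Prop}
    (hr : ∀ i, Equivalence (r i)) (hsep : ∀ x y, x ≠ y → ∃ i, ¬ r i x y) (F : Finset X) :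
    ∃ L : List ι, L.length ≤ F.card - 1 ∧ (∀ i ∈ L, ∃ x ∈ F, ∃ y ∈ F, ¬ r i x y) ∧
      ∀ x ∈ F, ∀ y ∈ F, (∀ i ∈ L, r i x y) → x = y := by
  classical
  induction F using Finset.induction_on with
  | empty => exact ⟨[], by simp⟩
  | insert x F hx ih =>
    obtain ⟨L, hlen, hsplit, hL⟩ := ih
    by_cases h : ∃ y ∈ F, ∀ i ∈ L, r i x y
    · obtain ⟨y, hy, hxy⟩ := h
      have hne : x ≠ y := fun e => hx (e ▸ hy)
      obtain ⟨j, hj⟩ := hsep x y hne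
      have hpos : 0 < F.card := Finset.card_pos.2 ⟨y, hy⟩
      -- The old relations already separate the points of `F`, so `y` is the only one they confuse
      -- with `x`; one further relation, separating `x` from `y`, is enough.
      have key : ∀ z ∈ F, ¬ ∀ i ∈ j :: L, r i x z := by
        intro z hz hall
        have : y = z := hL y hy z hz fun i hi =>
          (hr i).trans ((hr i).symm (hxy i hi)) (hall i (List.mem_cons_of_mem _ hi))
        exact hj (this ▸ hall j List.mem_cons_self)
      refine ⟨j :: L, ?_, ?_, ?_⟩
      · rw [Finset.card_insert_of_notMem hx, List.length_cons]
        omega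
      · intro i hi
        rcases List.mem_cons.1 hi with rfl | hi
        · exact ⟨x, by simp, y, by simp [hy], hj⟩
        · obtain ⟨a, ha, b, hb, hab⟩ := hsplit i hi
          exact ⟨a, by simp [ha], b, by simp [hb], hab⟩
      · intro a ha b hb hab
        rcases Finset.mem_insert.1 ha with rfl | ha' <;> rcases Finset.mem_insert.1 hb with rfl | hb'
        · rfl
        · exact absurd hab (key b hb')
        · exact absurd (fun i hi => (hr i).symm (hab i hi)) (key a ha')
        · exact hL a ha' b hb' fun i hi => hab i (List.mem_cons_of_mem _ hi)
    · push Not at h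
      refine ⟨L, ?_, ?_, ?_⟩
      · rw [Finset.card_insert_of_notMem hx]
        omega
      · intro i hi
        obtain ⟨a, ha, b, hb, hab⟩ := hsplit i hi
        exact ⟨a, by simp [ha], b, by simp [hb], hab⟩
      · intro a ha b hb hab
        rcases Finset.mem_insert.1 ha with rfl | ha' <;> rcases Finset.mem_insert.1 hb with rfl | hb'
        · rfl
        · obtain ⟨i, hi, hn⟩ := h b hb'
          exact absurd (hab i hi) hn
        · obtain ⟨i, hi, hn⟩ := h a ha'
          exact absurd ((hr i).symm (hab i hi)) hn
        · exact hL a ha' b hb' hab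

/-- A relation is peelable if each finite set `A` can be enlarged, to about twice its size, so that
the elements of `G` which stabilize the larger set also stabilize `A` and respect the relation
on `A`. -/
def IsPeelable {X : Type*} (G : Subgroup (Equiv.Perm X)) (r : X → X → Prop) : Prop :=
  ∀ A : Finset X, 2 ≤ A.card → ∃ B, A ⊆ B ∧ B.card ≤ 2 * A.card + 1 ∧
    ∀ g ∈ G, (∀ x, g x ∈ B ↔ x ∈ B) → (∀ x, g x ∈ A ↔ x ∈ A) ∧ ∀ x ∈ A, r x (g x)

/-- Enlargements are nested, one for each relation. A stabilizer of the outermost set is peeled back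
layer by layer to the innermost. Each layer at most doubles `card + 1`. -/
theorem IsPeelable.exists_superset {X ι : Type*} {G : Subgroup (Equiv.Perm X)}
    {r : ι → X → X → Prop} (hr : ∀ i, IsPeelable G (r i)) (L : List ι) (A : Finset X)
    (hA : 2 ≤ A.card) : ∃ B, A ⊆ B ∧ B.card + 1 ≤ 2 ^ L.length * (A.card + 1) ∧
    ∀ g ∈ G, (∀ x, g x ∈ B ↔ x ∈ B) →
      (∀ x, g x ∈ A ↔ x ∈ A) ∧ ∀ x ∈ A, ∀ i ∈ L, r i x (g x) := by
  induction L generalizing A with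
  | nil => exact ⟨A, subset_rfl, by simp, fun g _ h => ⟨h, by simp⟩⟩
  | cons i L ih =>
    obtain ⟨B, hAB, hB, hgB⟩ := hr i A hA
    obtain ⟨C, hBC, hC, hgC⟩ := ih B (hA.trans (Finset.card_le_card hAB))
    refine ⟨C, hAB.trans hBC, ?_, ?_⟩
    · calc C.card + 1 ≤ 2 ^ L.length * (B.card + 1) := hC
        _ ≤ 2 ^ L.length * (2 * (A.card + 1)) := Nat.mul_le_mul_left _ (by omega)
        _ = _ := by rw [List.length_cons, pow_succ, mul_assoc]
    · intro g hg h
      obtain ⟨h1, h2⟩ := hgC g hg h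
      obtain ⟨h3, h4⟩ := hgB g hg h1
      refine ⟨h3, fun x hx j hj => ?_⟩
      rcases List.mem_cons.1 hj with rfl | hj
      · exact h4 x hx
      · exact h2 x (hAB hx) j hj

theorem exists_isRigidExtension_of_card_le_one {X : Type*} (G : Subgroup (Equiv.Perm X))
    {F : Finset X} (hF : F.card ≤ 1) : ∃ A, IsRigidExtension G F A := by
  refine ⟨F, subset_rfl, ?_, fun g _ h x hx => Finset.card_le_one.1 hF _ ((h x).2 hx) _ hx⟩
  have : 2 ^ 1 ≤ 2 ^ (F.card ^ 2 - F.card + 2) := Nat.pow_le_pow_right (by norm_num) (by omega)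
  omega

theorem exists_isRigidExtension_of_isPeelable {X ι : Type*} {G : Subgroup (Equiv.Perm X)}
    {r : ι → X → X → Prop} (hr : ∀ i, Equivalence (r i))
    (hsep : ∀ x y, x ≠ y → ∃ i, ¬ r i x y) (hpeel : ∀ i, IsPeelable G (r i)) (F : Finset X) :
    ∃ A, IsRigidExtension G F A := by
  rcases le_or_gt F.card 1 with hF | hF
  · exact exists_isRigidExtension_of_card_le_one G hF
  obtain ⟨L, hlen, -, hL⟩ := exists_separating_list hr hsep F
  obtain ⟨A, hFA, hA, hgA⟩ := IsPeelable.exists_superset hpeel L F hF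
  refine ⟨A, hFA, ?_, ?_⟩
  · obtain ⟨k, hk⟩ : ∃ k, F.card = k + 2 := ⟨F.card - 2, by omega⟩
    rw [hk] at hlen hA ⊢
    -- With `|F| = k + 2`, at most `k + 1` doublings are made, so `|A| + 1 ≤ 2 ^ (k + 1) * (|F| + 1)
    -- ≤ 2 ^ (2 * k + 3)`, well within the bound.
    have h1 : k + 2 + 1 ≤ 2 ^ (k + 2) := Nat.lt_two_pow_self
    have h2 : A.card + 1 ≤ 2 ^ (k + 1) * 2 ^ (k + 2) :=
      hA.trans (Nat.mul_le_mul (Nat.pow_le_pow_right (by norm_num) (by omega)) h1)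
    have h3 : 2 ^ (k + 1) * 2 ^ (k + 2) ≤ 2 ^ ((k + 2) ^ 2 - (k + 2) + 2) := by
      rw [← pow_add]
      apply Nat.pow_le_pow_right (by norm_num)
      have : (k + 2) ^ 2 = k * k + 4 * k + 4 := by ring
      omega
    omega
  · intro g hg h x hx
    obtain ⟨h1, h2⟩ := hgA g hg h
    exact (hL x hx (g x) ((h1 x).2 hx) (h2 x hx)).symm

/-! ### Ultrafilters and generic sequences -/

theorem exists_ultrafilter_of_infinite {X : Type*} {S : Set X} (hS : S.Infinite) :
    ∃ U : Ultrafilter X, (U : Filter X) ≤ cofinite ∧ S ∈ U := by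
  have := hS.cofinite_inf_principal_neBot
  have h := Ultrafilter.of_le (cofinite ⊓ 𝓟 S)
  exact ⟨_, h.trans inf_le_left, le_principal_iff.1 (h.trans inf_le_right)⟩

/-- The set of points which are related to almost all points, in the sense of `U`. -/
def relLimit {X : Type*} (R : X → X → Prop) (U : Ultrafilter X) : Set X :=
  {w | ∀ᶠ z in U, R w z}

theorem mem_relLimit {X : Type*} {R : X → X → Prop} {U : Ultrafilter X} {w : X} :
    w ∈ relLimit R U ↔ {z | R w z} ∈ U :=
  Iff.rfl

theorem eventually_rel_iff_mem_relLimit {X : Type*} (R : X → X → Prop) (U : Ultrafilter X)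
    (w : X) : ∀ᶠ z in U, R w z ↔ w ∈ relLimit R U := by
  by_cases h : w ∈ relLimit R U
  · have h' : ∀ᶠ z in U, R w z := h
    filter_upwards [h'] with z hz
    simp [hz, h]
  · have h' : ∀ᶠ z in U, ¬ R w z := Ultrafilter.eventually_not.2 h
    filter_upwards [h'] with z hz
    simp [hz, h]

theorem Ultrafilter.eventually_mem_iff {X : Type*} (U : Ultrafilter X) (Q : Set X) :
    ∀ᶠ z in U, z ∈ Q ↔ Q ∈ U := by
  by_cases h : Q ∈ U
  · filter_upwards [h] with z hz
    simp [hz, h]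
  · filter_upwards [Ultrafilter.compl_mem_iff_notMem.2 h] with z hz
    simp only [h, iff_false]
    exact hz

theorem Ultrafilter.eventually_notMem_finset {X : Type*} {U : Ultrafilter X}
    (hU : (U : Filter X) ≤ cofinite) (A : Finset X) : ∀ᶠ z in U, z ∉ A :=
  hU (A.finite_toSet.subset fun z hz => by simpa using hz)

theorem relLimit_equivalence {X : Type*} (R : X → X → Prop) (U : Ultrafilter X) :
    Equivalence fun x y => x ∈ relLimit R U ↔ y ∈ relLimit R U :=
  ⟨fun _ => Iff.rfl, Iff.symm, Iff.trans⟩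

/-- A sequence of `U`-generic points over a finite set. -/
theorem exists_generic_seq {X : Type*} (R : X → X → Prop) {U : Ultrafilter X}
    (hU : (U : Filter X) ≤ cofinite) (A : Finset X) {Q : Set (Set X)} (hQ : Q.Finite) :
    ∃ b : ℕ → X, Function.Injective b ∧ (∀ t, b t ∉ A) ∧
      (∀ a ∈ A, ∀ t, R a (b t) ↔ a ∈ relLimit R U) ∧ (∀ q ∈ Q, ∀ t, b t ∈ q ↔ q ∈ U) ∧
      ∀ s t, s < t → (R (b s) (b t) ↔ relLimit R U ∈ U) := by
  obtain ⟨b, hb, hb'⟩ := exists_seq_of_forall_finset_exists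
    (fun z => z ∉ A ∧ (∀ a ∈ A, R a z ↔ a ∈ relLimit R U) ∧ (∀ q ∈ Q, z ∈ q ↔ q ∈ U) ∧
      (z ∈ relLimit R U ↔ relLimit R U ∈ U))
    (fun x y => y ≠ x ∧ (R x y ↔ relLimit R U ∈ U)) (by
      intro s hs
      have h1 := Ultrafilter.eventually_notMem_finset hU A
      have h2 : ∀ᶠ z in U, ∀ a ∈ A, R a z ↔ a ∈ relLimit R U :=
        (eventually_all_finset A).2 fun a _ => eventually_rel_iff_mem_relLimit R U a
      have h3 : ∀ᶠ z in U, ∀ q ∈ Q, z ∈ q ↔ q ∈ U :=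
        (eventually_all_finite hQ).2 fun q _ => U.eventually_mem_iff q
      have h4 := U.eventually_mem_iff (relLimit R U)
      have h5 := Ultrafilter.eventually_notMem_finset hU s
      have h6 : ∀ᶠ z in U, ∀ x ∈ s, R x z ↔ x ∈ relLimit R U :=
        (eventually_all_finset s).2 fun a _ => eventually_rel_iff_mem_relLimit R U a
      obtain ⟨z, z1, z2, z3, z4, z5, z6⟩ :=
        (h1.and (h2.and (h3.and (h4.and (h5.and h6))))).exists
      exact ⟨z, ⟨z1, z2, z3, z4⟩, fun x hx =>
        ⟨fun e => z5 (e ▸ hx), (z6 x hx).trans (hs x hx).2.2.2⟩⟩)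
  refine ⟨b, ?_, fun t => (hb t).1, fun a ha t => (hb t).2.1 a ha,
    fun q hq t => (hb t).2.2.1 q hq, fun s t hst => (hb' s t hst).2⟩
  intro s t h
  rcases lt_trichotomy s t with hst | hst | hst
  · exact absurd h.symm (hb' s t hst).1
  · exact hst
  · exact absurd h (hb' t s hst).1

/-! ### Tournaments -/

/-- A tournament, that is, an irreflexive relation which relates any two distinct points in
exactly one direction. -/
structure IsTournamentRel {X : Type*} (R : X → X → Prop) : Prop where
  asymm : ∀ x y, R x y → ¬ R y x
  total : ∀ x y, x ≠ y → R x y ∨ R y x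

theorem IsTournamentRel.flip {X : Type*} {R : X → X → Prop} (hR : IsTournamentRel R) :
    IsTournamentRel (flip R) :=
  ⟨fun x y h => hR.asymm y x h, fun x y h => hR.total y x h.symm⟩

theorem IsTournamentRel.not_rel_iff {X : Type*} {R : X → X → Prop} (hR : IsTournamentRel R)
    {x y : X} (h : x ≠ y) : ¬ R x y ↔ R y x :=
  ⟨fun hn => (hR.total x y h).resolve_left hn, fun h' => hR.asymm y x h'⟩

open Classical in
/-- A long transitive chain, all of whose members look the same to the points of `A`, is fixed
pointwise by the automorphisms of the tournament which it forms together with `A`. -/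
theorem IsTournamentRel.chain_fixed {X : Type*} {R : X → X → Prop} (hR : IsTournamentRel R)
    {A : Finset X} {b : ℕ → X} (hinj : Function.Injective b) (hbA : ∀ t, b t ∉ A)
    (hhom : ∀ a ∈ A, ∀ s t, R a (b s) ↔ R a (b t)) (hchain : ∀ s t, s < t → R (b s) (b t))
    {m : ℕ} (hm : A.card < m) (g : Equiv.Perm X) (hg : ∀ x y, R (g x) (g y) ↔ R x y)
    (hgB : ∀ x, g x ∈ A ∪ (Finset.range m).image b ↔ x ∈ A ∪ (Finset.range m).image b) :
    ∀ t < m, g (b t) = b t := by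
  set B := A ∪ (Finset.range m).image b with hB
  have memB : ∀ t < m, b t ∈ B := fun t ht => by
    rw [hB, Finset.mem_union, Finset.mem_image]
    exact Or.inr ⟨t, Finset.mem_range.2 ht, rfl⟩
  have hchain' : ∀ s t, R (b s) (b t) ↔ s < t := by
    refine fun s t => ⟨fun h => ?_, hchain s t⟩
    by_contra hst
    rcases (not_lt.1 hst).eq_or_lt with e | hlt
    · subst e
      exact hR.asymm _ _ h h
    · exact hR.asymm _ _ h (hchain t s hlt)
  have hhom' : ∀ a ∈ A, ∀ s t, R (b s) a ↔ R (b t) a := by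
    intro a ha s t
    have hne : ∀ t, a ≠ b t := fun t e => hbA t (e ▸ ha)
    rw [← hR.not_rel_iff (hne s), ← hR.not_rel_iff (hne t), hhom a ha s t]
  have twin : ∀ t, t + 1 < m → ∀ z ∈ B, z ≠ b t → z ≠ b (t + 1) →
      (R z (b t) ↔ R z (b (t + 1))) := by
    intro t ht z hz h1 h2
    rcases Finset.mem_union.1 hz with hz | hz
    · exact hhom z hz _ _
    · obtain ⟨r, -, rfl⟩ := Finset.mem_image.1 hz
      have h1' : r ≠ t := fun e => h1 (e ▸ rfl)
      have h2' : r ≠ t + 1 := fun e => h2 (e ▸ rfl)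
      rw [hchain', hchain']
      omega
  have outdeg : ∀ x, (B.filter (R (g x))).card = (B.filter (R x)).card := by
    intro x
    symm
    refine Finset.card_bij (fun z _ => g z) ?_ (fun _ _ _ _ h => g.injective h) ?_
    · intro z hz
      rw [Finset.mem_filter] at hz ⊢
      exact ⟨(hgB z).2 hz.1, (hg x z).2 hz.2⟩
    · intro z hz
      rw [Finset.mem_filter] at hz
      refine ⟨g⁻¹ z, ?_, by simp⟩
      rw [Finset.mem_filter, ← hgB, ← hg]
      simpa using hz
  have outlt : ∀ s t, s < t → t < m → (B.filter (R (b t))).card < (B.filter (R (b s))).card := by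
    intro s t hst ht
    apply Finset.card_lt_card
    rw [Finset.ssubset_iff_of_subset]
    · refine ⟨b t, ?_, ?_⟩
      · rw [Finset.mem_filter]
        exact ⟨memB t ht, hchain s t hst⟩
      · rw [Finset.mem_filter]
        exact fun h => hR.asymm _ _ h.2 h.2
    · intro z hz
      rw [Finset.mem_filter] at hz ⊢
      refine ⟨hz.1, ?_⟩
      rcases Finset.mem_union.1 hz.1 with hzA | hzb
      · exact (hhom' z hzA s t).2 hz.2
      · obtain ⟨r, -, rfl⟩ := Finset.mem_image.1 hzb
        rw [hchain'] at hz ⊢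
        omega
  -- The chain is too long to be mapped into `A`, so some member goes to a member; out-degrees in
  -- `B` are preserved and strictly decrease along the chain, so that member is fixed. Fixedness
  -- then spreads along the chain in both directions, because consecutive members are distinguished
  -- by no other point of `B`, and neither are their images.
  obtain ⟨t₀, ht₀, hfix⟩ : ∃ t < m, g (b t) = b t := by
    have : ∃ t < m, g (b t) ∉ A := by
      by_contra! hcon
      have := Finset.card_le_card_of_injOn (s := Finset.range m) (t := A) (fun t => g (b t))
        (fun t ht => hcon t (by simpa using ht)) (fun s _ t _ h => hinj (g.injective h))
      rw [Finset.card_range] at this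
      omega
    obtain ⟨t, ht, hgt⟩ := this
    have := (hgB _).2 (memB t ht)
    obtain ⟨s, hs, hst⟩ := Finset.mem_image.1 ((Finset.mem_union.1 this).resolve_left hgt)
    have hs := Finset.mem_range.1 hs
    have hdeg := outdeg (b t)
    rw [← hst] at hdeg
    have : s = t := by
      rcases lt_trichotomy s t with h | h | h
      · have := outlt s t h ht
        omega
      · exact h
      · have := outlt t s h hs
        omega
    exact ⟨t, ht, by rw [← hst, this]⟩
  have twin' : ∀ t, t + 1 < m → ∀ z ∈ B, z ≠ g (b t) → z ≠ g (b (t + 1)) →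
      (R z (g (b t)) ↔ R z (g (b (t + 1)))) := by
    intro t ht z hz h1 h2
    have hz' : g (g⁻¹ z) = z := by simp
    rw [← hz'] at hz h1 h2 ⊢
    rw [hg, hg]
    exact twin t ht _ ((hgB _).1 hz) (fun e => h1 (e ▸ rfl)) (fun e => h2 (e ▸ rfl))
  have up : ∀ t, t + 1 < m → g (b t) = b t → g (b (t + 1)) = b (t + 1) := by
    intro t ht hf
    by_contra hne
    have hR1 : R (b t) (g (b (t + 1))) := by
      rw [← hf, hg]
      exact hchain _ _ (Nat.lt_succ_self t)
    have hne1 : g (b (t + 1)) ≠ b t := fun e => hR.asymm _ _ hR1 (by rw [e] at hR1 ⊢; exact hR1)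
    have hne2 : b (t + 1) ≠ b t := fun e => by simpa using hinj e
    have e1 := twin t ht _ ((hgB _).2 (memB _ ht)) hne1 hne
    have e2 := twin' t ht _ (memB _ ht) (by rwa [hf]) (Ne.symm hne)
    rw [hf] at e2
    have n1 : ¬ R (g (b (t + 1))) (b (t + 1)) := fun h => hR.asymm _ _ hR1 (e1.2 h)
    have n2 : ¬ R (b (t + 1)) (g (b (t + 1))) := fun h =>
      hR.asymm _ _ (hchain t (t + 1) (Nat.lt_succ_self t)) (e2.2 h)
    exact n2 ((hR.total _ _ hne).resolve_left n1)
  have down : ∀ t, t + 1 < m → g (b (t + 1)) = b (t + 1) → g (b t) = b t := by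
    intro t ht hf
    by_contra hne
    have hR0 : R (b t) (b (t + 1)) := hchain _ _ (Nat.lt_succ_self t)
    have hR1 : R (g (b t)) (b (t + 1)) := by
      rw [← hf, hg]
      exact hR0
    have hne1 : g (b t) ≠ b (t + 1) := fun e => hR.asymm _ _ hR1 (by rw [e] at hR1 ⊢; exact hR1)
    have hne2 : b t ≠ b (t + 1) := fun e => by simpa using hinj e
    have e1 := twin t ht _ ((hgB _).2 (memB _ (by omega))) hne hne1
    have e2 := twin' t ht _ (memB _ (by omega)) (Ne.symm hne) (by rwa [hf])
    rw [hf] at e2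
    exact hR.asymm _ _ (e1.2 hR1) (e2.2 hR0)
  have hup : ∀ k, t₀ + k < m → g (b (t₀ + k)) = b (t₀ + k) := by
    intro k
    induction k with
    | zero => exact fun _ => hfix
    | succ k ih => exact fun h => up (t₀ + k) h (ih (by omega))
  have hdown : ∀ k, ∀ t, t + k = t₀ → g (b t) = b t := by
    intro k
    induction k with
    | zero => rintro t rfl; exact hfix
    | succ k ih => exact fun t h => down t (by omega) (ih (t + 1) (by omega))
  intro t ht
  rcases le_total t₀ t with h | h
  · obtain ⟨k, rfl⟩ := Nat.exists_eq_add_of_le h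
    exact hup k ht
  · exact hdown (t₀ - t) t (by omega)

/-- The added points are `|A| + 1` generic ones. They form a transitive chain, increasing or
decreasing according to whether the limit of `U` belongs to `U`. Every member is fixed, so `A` is
stabilized, and the arc between `x` and the first member decides whether `x` lies in the limit. -/
theorem IsTournamentRel.isPeelable {X : Type*} {G : Subgroup (Equiv.Perm X)}
    {R : X → X → Prop} (hR : IsTournamentRel R) (hG : IsInvariantRel G R) {U : Ultrafilter X}
    (hU : (U : Filter X) ≤ cofinite) :
    IsPeelable G fun x y => x ∈ relLimit R U ↔ y ∈ relLimit R U := by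
  classical
  intro A _
  obtain ⟨b, hinj, hbA, hb, -, hbb⟩ := exists_generic_seq R hU A Set.finite_empty
  have hhom : ∀ a ∈ A, ∀ s t, R a (b s) ↔ R a (b t) := fun a ha s t =>
    (hb a ha s).trans (hb a ha t).symm
  refine ⟨A ∪ (Finset.range (A.card + 1)).image b, Finset.subset_union_left, ?_, ?_⟩
  · refine (Finset.card_union_le _ _).trans ?_
    have := Finset.card_image_le (s := Finset.range (A.card + 1)) (f := b)
    rw [Finset.card_range] at this
    omega
  intro g hg hgB
  have hfix : ∀ t < A.card + 1, g (b t) = b t := by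
    by_cases hε : relLimit R U ∈ U
    · exact hR.chain_fixed hinj hbA hhom (fun s t hst => (hbb s t hst).2 hε)
        (Nat.lt_succ_self _) g (hG g hg) hgB
    · refine hR.flip.chain_fixed hinj hbA ?_ ?_ (Nat.lt_succ_self _) g
        (fun x y => hG g hg y x) hgB
      · intro a ha s t
        have hne : ∀ t, a ≠ b t := fun t e => hbA t (e ▸ ha)
        change R (b s) a ↔ R (b t) a
        rw [← hR.not_rel_iff (hne s), ← hR.not_rel_iff (hne t), hhom a ha s t]
      · intro s t hst
        change R (b t) (b s)
        rw [← hR.not_rel_iff (fun e => hst.ne (hinj e)), hbb s t hst]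
        exact hε
  have hA : ∀ x, g x ∈ A ↔ x ∈ A := by
    intro x
    constructor
    · intro hx
      have := (hgB x).1 (Finset.mem_union_left _ hx)
      refine (Finset.mem_union.1 this).resolve_right fun h => ?_
      obtain ⟨t, ht, rfl⟩ := Finset.mem_image.1 h
      rw [hfix t (Finset.mem_range.1 ht)] at hx
      exact hbA t hx
    · intro hx
      have := (hgB x).2 (Finset.mem_union_left _ hx)
      refine (Finset.mem_union.1 this).resolve_right fun h => ?_
      obtain ⟨t, ht, hxt⟩ := Finset.mem_image.1 h
      have : x = b t := g.injective (by rw [hfix t (Finset.mem_range.1 ht), hxt])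
      exact hbA t (this ▸ hx)
  refine ⟨hA, fun x hx => ?_⟩
  change _ ↔ _
  rw [← hb x hx 0, ← hb (g x) ((hA x).2 hx) 0, ← hG g hg x (b 0), hfix 0 (Nat.succ_pos _)]

/-! ### Difference sets and counting along arcs -/

/-- The set of points which distinguish `x` and `y`, with respect to a binary function. -/
def diffSet {X γ : Type*} (f : X → X → γ) (x y : X) : Set X :=
  {z | f x z ≠ f y z}

theorem diffSet_comm {X γ : Type*} (f : X → X → γ) (x y : X) :
    diffSet f x y = diffSet f y x :=
  Set.ext fun _ => ne_comm

theorem diffSet_self {X γ : Type*} (f : X → X → γ) (x : X) : diffSet f x x = ∅ :=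
  Set.eq_empty_iff_forall_notMem.2 fun _ h => h rfl

theorem diffSet_subset_union {X γ : Type*} (f : X → X → γ) (x y z : X) :
    diffSet f x z ⊆ diffSet f x y ∪ diffSet f y z := by
  intro w hw
  by_contra h
  rw [Set.mem_union, not_or] at h
  exact hw ((not_not.1 h.1).trans (not_not.1 h.2))

theorem diffSet_finite_equivalence {X γ : Type*} (f : X → X → γ) :
    Equivalence fun x y => (diffSet f x y).Finite :=
  ⟨fun x => by rw [diffSet_self]; exact Set.finite_empty, fun h => by rwa [diffSet_comm],
    fun h h' => (h.union h').subset (diffSet_subset_union f _ _ _)⟩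

theorem diffSet_image {X γ : Type*} {f : X → X → γ} {g : Equiv.Perm X}
    (hg : ∀ x y, f (g x) (g y) = f x y) (x y : X) :
    diffSet f (g x) (g y) = g '' diffSet f x y := by
  ext z
  rw [Equiv.image_eq_preimage_symm]
  change _ ≠ _ ↔ _ ≠ _
  rw [← hg x, ← hg y, Equiv.apply_symm_apply]

theorem diffSet_finite_dichotomy {X γ : Type*} {G : Subgroup (Equiv.Perm X)}
    (hprim : MulAction.IsPreprimitive G X) {f : X → X → γ}
    (hf : ∀ g ∈ G, ∀ x y, f (g x) (g y) = f x y) :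
    (∀ x y, x ≠ y → (diffSet f x y).Infinite) ∨ ∀ x y, (diffSet f x y).Finite := by
  refine (eq_or_forall_of_isPreprimitive hprim (diffSet_finite_equivalence f)
    (IsInvariantRel.of_imp fun g hg x y h => ?_)).imp_left fun h x y hxy hfin => hxy (h x y hfin)
  rw [diffSet_image (hf g hg)]
  exact h.image g

theorem IsInvariantRel.apply_eq {X : Type*} {G : Subgroup (Equiv.Perm X)} {R : X → X → Prop}
    (hG : IsInvariantRel G R) : ∀ g ∈ G, ∀ x y, R (g x) (g y) = R x y :=
  fun g hg x y => propext (hG g hg x y)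

theorem diffSet_mem_iff {X : Type*} (R : X → X → Prop) (U : Ultrafilter X) (x y : X) :
    diffSet R x y ∈ U ↔ ¬ (x ∈ relLimit R U ↔ y ∈ relLimit R U) := by
  have h := (eventually_rel_iff_mem_relLimit R U x).and (eventually_rel_iff_mem_relLimit R U y)
  constructor
  · intro hd hiff
    obtain ⟨z, ⟨h1, h2⟩, hz⟩ := (h.and hd).exists
    exact hz (propext (h1.trans (hiff.trans h2.symm)))
  · intro hn
    filter_upwards [h] with z hz
    exact fun e => hn (hz.1.symm.trans ((iff_of_eq e).trans hz.2))

/-- Any two pairs in the relation are equivalent under `G`, up to reversal. -/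
def IsArcTransitive {X : Type*} (G : Subgroup (Equiv.Perm X)) (R : X → X → Prop) : Prop :=
  ∀ x y x' y', R x y → R x' y' → ∃ g ∈ G, (g x = x' ∧ g y = y') ∨ (g x = y' ∧ g y = x')

/-- A set of pairs which is invariant and symmetric has constant size along the arcs. -/
theorem IsArcTransitive.ncard_eq {X Y : Type*} {G : Subgroup (Equiv.Perm X)} {R : X → X → Prop}
    (harc : IsArcTransitive G R) {S : X → X → Set Y} (hcomm : ∀ x y, S x y = S y x)
    (hinv : ∀ g ∈ G, ∀ x y, (S (g x) (g y)).ncard = (S x y).ncard) {x y x' y' : X}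
    (h : R x y) (h' : R x' y') : (S x y).ncard = (S x' y').ncard := by
  obtain ⟨g, hg, ⟨rfl, rfl⟩ | ⟨rfl, rfl⟩⟩ := harc x y x' y' h h'
  · exact (hinv g hg x y).symm
  · rw [hcomm (g y), hinv g hg]

theorem IsArcTransitive.ncard_diffSet_eq {X γ : Type*} {G : Subgroup (Equiv.Perm X)}
    {R : X → X → Prop} (harc : IsArcTransitive G R) {f : X → X → γ}
    (hf : ∀ g ∈ G, ∀ x y, f (g x) (g y) = f x y) {x y x' y' : X}
    (h : R x y) (h' : R x' y') : (diffSet f x y).ncard = (diffSet f x' y').ncard := by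
  refine harc.ncard_eq (diffSet_comm f) (fun g hg x y => ?_) h h'
  rw [diffSet_image (hf g hg), Set.ncard_image_of_injective _ g.injective]

/-- All arcs have difference sets of one finite size. For finitely many `z` in `T`, all but finitely
many out-neighbours `y` of `u` are also out-neighbours of every `z`, so all these `z` lie in
`diffSet R u y`. Taking one more `z` than that common size is a contradiction. -/
theorem IsArcTransitive.not_infinite_of_diffSet_finite {X : Type*}
    {G : Subgroup (Equiv.Perm X)} {R : X → X → Prop} (harc : IsArcTransitive G R)
    (hG : IsInvariantRel G R) (hfin : ∀ x y, (diffSet R x y).Finite) {u : X}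
    (hN : {y | R u y}.Infinite) {T : Set X}
    (hT : ∀ z ∈ T, ∀ y, z ≠ y → R u y → R z y → z ∈ diffSet R u y) : T.Finite := by
  by_contra hTinf
  obtain ⟨y₀, hy₀⟩ := hN.nonempty
  obtain ⟨Z, hZT, hZ⟩ := Set.Infinite.exists_subset_card_eq hTinf ((diffSet R u y₀).ncard + 1)
  have hbad : ((⋃ z ∈ Z, diffSet R u z) ∪ Z).Finite :=
    (Z.finite_toSet.biUnion fun z _ => hfin u z).union Z.finite_toSet
  obtain ⟨y, hy, hyn⟩ := (hN.sdiff hbad).nonempty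
  rw [Set.mem_union, not_or] at hyn
  have hsub : (Z : Set X) ⊆ diffSet R u y := by
    intro z hz
    refine hT z (hZT hz) y (fun e => hyn.2 (e ▸ hz)) hy ?_
    by_contra hzy
    refine hyn.1 (Set.mem_biUnion (Finset.mem_coe.1 hz) fun e => hzy ?_)
    rw [← e]
    exact hy
  have h1 := Set.ncard_le_ncard hsub (hfin u y)
  rw [Set.ncard_coe_finset, hZ, harc.ncard_diffSet_eq hG.apply_eq hy hy₀] at h1
  omega

theorem IsTournamentRel.exists_isRigidExtension {X : Type*} {G : Subgroup (Equiv.Perm X)}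
    (hprim : MulAction.IsPreprimitive G X) {R : X → X → Prop} (hR : IsTournamentRel R)
    (hG : IsInvariantRel G R) (harc : IsArcTransitive G R) {u : X} (hN : {y | R u y}.Infinite)
    (F : Finset X) : ∃ A, IsRigidExtension G F A := by
  refine exists_isRigidExtension_of_isPeelable
    (ι := {U : Ultrafilter X // (U : Filter X) ≤ cofinite})
    (fun U => relLimit_equivalence R U.1) (fun x y hxy => ?_)
    (fun U => hR.isPeelable hG U.2) F
  rcases diffSet_finite_dichotomy hprim hG.apply_eq with h | h
  · obtain ⟨U, hU, hmem⟩ := exists_ultrafilter_of_infinite (h x y hxy)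
    exact ⟨⟨U, hU⟩, (diffSet_mem_iff R U x y).1 hmem⟩
  · refine absurd (harc.not_infinite_of_diffSet_finite hG h hN (T := {y | R u y}) ?_) hN
    intro z hz y _ _ hzy e
    exact hR.asymm _ _ hzy (e.mp hz)

/-! ### Locally finite graphs -/

theorem SimpleGraph.dist_apply_eq {X : Type*} {Γ : SimpleGraph X} (hΓ : Γ.Connected)
    {G : Subgroup (Equiv.Perm X)} (hG : IsInvariantRel G Γ.Adj) :
    ∀ g ∈ G, ∀ x y, Γ.dist (g x) (g y) = Γ.dist x y := by
  have hle : ∀ g ∈ G, ∀ x y, Γ.dist (g x) (g y) ≤ Γ.dist x y := by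
    intro g hg x y
    obtain ⟨p, hp⟩ := hΓ.exists_walk_length_eq_dist x y
    let φ : Γ →g Γ := ⟨g, fun {a b} h => (hG g hg a b).2 h⟩
    have := SimpleGraph.dist_le (p.map φ)
    rw [SimpleGraph.Walk.length_map, hp] at this
    exact this
  intro g hg x y
  refine (hle g hg x y).antisymm ?_
  simpa using hle g⁻¹ (G.inv_mem hg) (g x) (g y)

theorem SimpleGraph.finite_ball {X : Type*} {Γ : SimpleGraph X} (hΓ : Γ.Connected)
    (hfin : ∀ x, {y | Γ.Adj x y}.Finite) (n : ℕ) (x : X) : {y | Γ.dist x y ≤ n}.Finite := by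
  induction n generalizing x with
  | zero =>
    refine (Set.finite_singleton x).subset fun y hy => ?_
    have := hΓ.dist_eq_zero_iff.1 (Nat.le_zero.1 hy)
    exact this.symm
  | succ n ih =>
    refine ((Set.finite_singleton x).union ((hfin x).biUnion fun z _ => ih z)).subset ?_
    intro y hy
    obtain ⟨p, hp⟩ := hΓ.exists_walk_length_eq_dist x y
    cases p with
    | nil => exact Or.inl rfl
    | cons h q =>
      refine Or.inr (Set.mem_biUnion h ?_)
      have h1 := SimpleGraph.dist_le q
      have h2 : Γ.dist x y ≤ n + 1 := hy
      rw [SimpleGraph.Walk.length_cons] at hp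
      change Γ.dist _ y ≤ n
      omega

/-- One point `b` is added, farther from each point of `A` than the diameter of `A`. If `b` moved,
its image would lie in `A`, and every point of `A` would have to go to `b`, since its distance from
`b` is too large to occur within `A`; two points in `A` make this absurd. Once `b` is fixed,
distances to `b` are preserved. -/
theorem SimpleGraph.isPeelable_dist {X : Type*} {Γ : SimpleGraph X} (hΓ : Γ.Connected)
    (hfin : ∀ x, {y | Γ.Adj x y}.Finite) {G : Subgroup (Equiv.Perm X)}
    (hG : IsInvariantRel G Γ.Adj) {U : Ultrafilter X} (hU : (U : Filter X) ≤ cofinite) :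
    IsPeelable G fun x y => ∀ᶠ b in U, Γ.dist x b = Γ.dist y b := by
  classical
  intro A hA
  have h1 : ∀ᶠ b in U, ∀ a ∈ A, ∀ x ∈ A, ∀ y ∈ A, Γ.dist x y < Γ.dist a b := by
    refine (eventually_all_finset A).2 fun a _ => (eventually_all_finset A).2 fun x _ =>
      (eventually_all_finset A).2 fun y _ => hU ?_
    refine (SimpleGraph.finite_ball hΓ hfin (Γ.dist x y) a).subset fun b hb => ?_
    exact not_lt.1 (by simpa using hb)
  have h2 : ∀ᶠ b in U, ∀ x ∈ A, ∀ y ∈ A, Γ.dist x b = Γ.dist y b →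
      ∀ᶠ b in U, Γ.dist x b = Γ.dist y b := by
    refine (eventually_all_finset A).2 fun x _ => (eventually_all_finset A).2 fun y _ => ?_
    by_cases h : ∀ᶠ b in U, Γ.dist x b = Γ.dist y b
    · exact Eventually.of_forall fun _ _ => h
    · filter_upwards [Ultrafilter.eventually_not.2 h] with b hb e
      exact absurd e hb
  obtain ⟨b, ⟨hb1, hb2⟩, hbA⟩ :=
    ((h1.and h2).and (Ultrafilter.eventually_notMem_finset hU A)).exists
  have hd := SimpleGraph.dist_apply_eq hΓ hG
  refine ⟨insert b A, Finset.subset_insert b A, (Finset.card_insert_le b A).trans (by omega), ?_⟩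
  intro g hg hgB
  have hgb : g b = b := by
    by_contra hne
    have hgbA : g b ∈ A :=
      Finset.mem_of_mem_insert_of_ne ((hgB b).2 (Finset.mem_insert_self b A)) hne
    have key : ∀ c ∈ A, g c = b := by
      intro c hc
      by_contra hcb
      have hgc : g c ∈ A :=
        Finset.mem_of_mem_insert_of_ne ((hgB c).2 (Finset.mem_insert_of_mem hc)) hcb
      have := hb1 c hc (g c) hgc (g b) hgbA
      rw [hd g hg] at this
      exact this.false
    obtain ⟨c, hc, c', hc', hcc⟩ := Finset.one_lt_card.1 hA
    exact hcc (g.injective ((key c hc).trans (key c' hc').symm))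
  have hgA : ∀ x, g x ∈ A ↔ x ∈ A := by
    intro x
    have := hgB x
    rw [Finset.mem_insert, Finset.mem_insert] at this
    by_cases hx : x = b
    · rw [hx, hgb]
    · have hx' : g x ≠ b := fun e => hx (g.injective (e.trans hgb.symm))
      simpa [hx, hx'] using this
  refine ⟨hgA, fun x hx => hb2 x hx (g x) ((hgA x).2 hx) ?_⟩
  conv_rhs => rw [← hgb]
  exact (hd g hg x b).symm

theorem SimpleGraph.exists_isRigidExtension_of_finite {X : Type*} [Infinite X]
    {G : Subgroup (Equiv.Perm X)} (hprim : MulAction.IsPreprimitive G X) {Γ : SimpleGraph X}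
    (hΓ : Γ.Connected) (hfin : ∀ x, {y | Γ.Adj x y}.Finite) (hG : IsInvariantRel G Γ.Adj)
    (F : Finset X) : ∃ A, IsRigidExtension G F A := by
  refine exists_isRigidExtension_of_isPeelable
    (ι := {U : Ultrafilter X // (U : Filter X) ≤ cofinite})
    (r := fun U x y => ∀ᶠ b in U.1, Γ.dist x b = Γ.dist y b)
    (fun U => ⟨fun x => Eventually.of_forall fun _ => rfl, fun h => h.mono fun _ e => e.symm,
      fun h h' => (h.and h').mono fun _ e => e.1.trans e.2⟩) (fun x y hxy => ?_)
    (fun U => SimpleGraph.isPeelable_dist hΓ hfin hG U.2) F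
  rcases diffSet_finite_dichotomy hprim (SimpleGraph.dist_apply_eq hΓ hG) with h | h
  · obtain ⟨U, hU, hmem⟩ := exists_ultrafilter_of_infinite (h x y hxy)
    refine ⟨⟨U, hU⟩, fun hev => ?_⟩
    obtain ⟨z, hz, hz'⟩ := (hev.and hmem).exists
    exact hz' hz
  · exfalso
    -- The first step `z` of a geodesic from `x` to `b` is nearer to `b` than `x` is, so `b` lies in
    -- the difference set of `x` and its neighbour `z`. Finitely many finite sets would cover `X`.
    have : (Set.univ : Set X).Finite := by
      refine ((Set.finite_singleton x).union ((hfin x).biUnion fun z _ => h x z)).subset ?_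
      intro b _
      obtain ⟨p, hp⟩ := hΓ.exists_walk_length_eq_dist x b
      cases p with
      | nil => exact Or.inl rfl
      | cons ha q =>
        refine Or.inr (Set.mem_biUnion ha ?_)
        have h1 := SimpleGraph.dist_le q
        rw [SimpleGraph.Walk.length_cons] at hp
        change Γ.dist _ _ ≠ Γ.dist _ _
        omega
    exact Set.infinite_univ this

/-! ### Typed ultrafilters and their limit points -/

/-- A nonprincipal ultrafilter whose generic sequences are cliques (if `ε` holds) or independent
sets (otherwise). -/
def IsTyped {X : Type*} (R : X → X → Prop) (ε : Prop) (U : Ultrafilter X) : Prop :=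
  (U : Filter X) ≤ cofinite ∧ (relLimit R U ∈ U ↔ ε)

/-- The ultrafilters of the given type do not distinguish the limit of `U` from the neighbourhood
of `z`. -/
def IsTypedLimit {X : Type*} (R : X → X → Prop) (ε : Prop) (U : Ultrafilter X) (z : X) : Prop :=
  IsTyped R ε U ∧ ∀ V, IsTyped R ε V → (relLimit R U ∈ V ↔ z ∈ relLimit R V)

/-- The points which are the limit of an ultrafilter that separates `x` and `y`. -/
def limitSeparators {X : Type*} (R : X → X → Prop) (ε : Prop) (x y : X) : Set X :=
  {z | ∃ U, IsTypedLimit R ε U z ∧ ¬ (x ∈ relLimit R U ↔ y ∈ relLimit R U)}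

section

variable {X : Type*} {R : X → X → Prop} {ε : Prop} {g : Equiv.Perm X}

theorem preimage_relLimit_map (hg : ∀ x y, R (g x) (g y) ↔ R x y) (U : Ultrafilter X) :
    g ⁻¹' relLimit R (U.map g) = relLimit R U := by
  ext x
  rw [Set.mem_preimage, mem_relLimit, mem_relLimit, Ultrafilter.mem_map]
  have : g ⁻¹' {z | R (g x) z} = {z | R x z} := Set.ext fun z => hg x z
  rw [this]

theorem apply_mem_relLimit_map (hg : ∀ x y, R (g x) (g y) ↔ R x y) (U : Ultrafilter X) (x : X) :
    g x ∈ relLimit R (U.map g) ↔ x ∈ relLimit R U := by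
  rw [← preimage_relLimit_map hg U, Set.mem_preimage]

theorem relLimit_map_mem_map (hg : ∀ x y, R (g x) (g y) ↔ R x y) (U V : Ultrafilter X) :
    relLimit R (U.map g) ∈ V.map g ↔ relLimit R U ∈ V := by
  rw [Ultrafilter.mem_map, preimage_relLimit_map hg]

theorem IsTyped.map (hg : ∀ x y, R (g x) (g y) ↔ R x y) {U : Ultrafilter X}
    (hU : IsTyped R ε U) : IsTyped R ε (U.map g) := by
  refine ⟨?_, (relLimit_map_mem_map hg U U).trans hU.2⟩
  rw [Ultrafilter.coe_map]
  exact (Filter.map_mono hU.1).trans g.injective.tendsto_cofinite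

theorem IsTypedLimit.map (hg : ∀ x y, R (g x) (g y) ↔ R x y) {U : Ultrafilter X} {z : X}
    (hU : IsTypedLimit R ε U z) : IsTypedLimit R ε (U.map g) (g z) := by
  refine ⟨hU.1.map hg, fun V hV => ?_⟩
  have hg' : ∀ x y, R (g⁻¹ x) (g⁻¹ y) ↔ R x y := fun x y => by
    rw [← hg]
    simp
  have hVV : (V.map (g⁻¹ : Equiv.Perm X)).map g = V := by
    rw [Ultrafilter.map_map]
    convert Ultrafilter.map_id V
    ext x
    simp
  rw [← hVV, relLimit_map_mem_map hg, apply_mem_relLimit_map hg]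
  exact hU.2 _ (hV.map hg')

end

theorem image_limitSeparators_subset {X : Type*} {R : X → X → Prop} (ε : Prop)
    {g : Equiv.Perm X} (hg : ∀ x y, R (g x) (g y) ↔ R x y) (x y : X) :
    g '' limitSeparators R ε x y ⊆ limitSeparators R ε (g x) (g y) := by
  rintro _ ⟨z, ⟨U, hU, hsep⟩, rfl⟩
  refine ⟨U.map g, hU.map hg, ?_⟩
  rwa [apply_mem_relLimit_map hg, apply_mem_relLimit_map hg]

theorem image_limitSeparators {X : Type*} {G : Subgroup (Equiv.Perm X)} {R : X → X → Prop}
    (hG : IsInvariantRel G R) (ε : Prop) {g : Equiv.Perm X} (hg : g ∈ G) (x y : X) :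
    g '' limitSeparators R ε x y = limitSeparators R ε (g x) (g y) := by
  refine (image_limitSeparators_subset ε (hG g hg) x y).antisymm fun z hz => ?_
  have := image_limitSeparators_subset ε (hG g⁻¹ (G.inv_mem hg)) (g x) (g y)
    (Set.mem_image_of_mem _ hz)
  exact ⟨g⁻¹ z, by simpa using this, by simp⟩

theorem limitSeparators_comm {X : Type*} (R : X → X → Prop) (ε : Prop) (x y : X) :
    limitSeparators R ε x y = limitSeparators R ε y x :=
  Set.ext fun _ => exists_congr fun _ => and_congr_right fun _ => not_congr Iff.comm

theorem limitSeparators_finite_equivalence {X : Type*} (R : X → X → Prop) (ε : Prop) :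
    Equivalence fun x y => (limitSeparators R ε x y).Finite := by
  refine ⟨fun x => ?_, fun h => by rwa [limitSeparators_comm], fun h h' =>
    (h.union h').subset ?_⟩
  · convert Set.finite_empty
    exact Set.eq_empty_iff_forall_notMem.2 fun z ⟨U, _, h⟩ => h Iff.rfl
  · rintro w ⟨U, hU, hw⟩
    by_contra h
    rw [Set.mem_union, not_or] at h
    have h1 := not_not.1 fun hn => h.1 ⟨U, hU, hn⟩
    have h2 := not_not.1 fun hn => h.2 ⟨U, hU, hn⟩
    exact hw (h1.trans h2)

/-- If `U` separates two points, and `z` ranges over infinitely many points that have a limit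
ultrafilter which does not look like `U` at a neighbour `u` of `U`, then too many of these
ultrafilters separate `u` from its `U`-generic neighbours. -/
theorem IsArcTransitive.finite_of_limitSeparators_finite {X : Type*}
    {G : Subgroup (Equiv.Perm X)} {R : X → X → Prop} (harc : IsArcTransitive G R)
    (hG : IsInvariantRel G R) {ε : Prop} (hfin : ∀ x y, (limitSeparators R ε x y).Finite)
    {L : X → Ultrafilter X} (hL : ∀ z, IsTypedLimit R ε (L z) z) {W : Ultrafilter X}
    (hW : IsTyped R ε W) {u : X} (hu : u ∈ relLimit R W) :
    {z | ¬ (u ∈ relLimit R (L z) ↔ z ∈ relLimit R W)}.Finite := by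
  by_contra hinf
  have hu' : ∀ᶠ y in W, R u y := hu
  obtain ⟨y₀, hy₀⟩ := hu'.exists
  obtain ⟨Z, hZT, hZ⟩ :=
    Set.Infinite.exists_subset_card_eq hinf ((limitSeparators R ε u y₀).ncard + 1)
  have hZev : ∀ᶠ y in W, ∀ z ∈ Z, y ∈ relLimit R (L z) ↔ relLimit R (L z) ∈ W :=
    (eventually_all_finset Z).2 fun z _ => W.eventually_mem_iff _
  obtain ⟨y, hy, hyZ⟩ := (hu'.and hZev).exists
  have hsub : (Z : Set X) ⊆ limitSeparators R ε u y := by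
    intro z hz
    refine ⟨L z, hL z, fun h => hZT hz ?_⟩
    -- For the generic `y`, membership in the limit of `L z` means that this limit belongs to `W`,
    -- that is, that `z` lies in the limit of `W`; by the choice of `z`, the point `u` behaves
    -- differently.
    rw [h, hyZ z hz, (hL z).2 W hW]
  have h1 := Set.ncard_le_ncard hsub (hfin u y)
  rw [Set.ncard_coe_finset, hZ, harc.ncard_eq (limitSeparators_comm R ε) (fun g hg x y => by
    rw [← image_limitSeparators hG ε hg, Set.ncard_image_of_injective _ g.injective]) hy hy₀] at h1
  omega

/-- If the ultrafilters of a given type separate points, then any two points are separated by one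
that is not a limit of given points. -/
theorem exists_separating_not_limit {X : Type*} [Infinite X] {G : Subgroup (Equiv.Perm X)}
    (hprim : MulAction.IsPreprimitive G X) {R : X → X → Prop} (hG : IsInvariantRel G R)
    (harc : IsArcTransitive G R) {ε : Prop}
    (hsep : ∀ x y, x ≠ y → ∃ U, IsTyped R ε U ∧ ¬ (x ∈ relLimit R U ↔ y ∈ relLimit R U))
    (F : Finset X) {x y : X} (hxy : x ≠ y) :
    ∃ U, IsTyped R ε U ∧ ¬ (x ∈ relLimit R U ↔ y ∈ relLimit R U) ∧
      ∀ u ∈ F, ∃ V, IsTyped R ε V ∧ ¬ (relLimit R U ∈ V ↔ u ∈ relLimit R V) := by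
  by_contra hcon
  have hlim : ∀ U, IsTyped R ε U → ¬ (x ∈ relLimit R U ↔ y ∈ relLimit R U) →
      ∃ u ∈ F, IsTypedLimit R ε U u := by
    intro U hU hs
    by_contra hno
    refine hcon ⟨U, hU, hs, fun u hu => ?_⟩
    by_contra hV
    refine hno ⟨u, hu, hU, fun V hVt => ?_⟩
    by_contra hne
    exact hV ⟨V, hVt, hne⟩
  have hfin₀ : (limitSeparators R ε x y).Finite := by
    refine F.finite_toSet.subset ?_
    rintro z ⟨U, hU, hs⟩
    obtain ⟨u, hu, hUu⟩ := hlim U hU.1 hs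
    -- An ultrafilter is a typed limit of at most one point, since the typed ultrafilters separate
    -- points; so only points of `F` can occur.
    have : z = u := by
      by_contra hne
      obtain ⟨V, hV, hVs⟩ := hsep z u hne
      exact hVs ((hU.2 V hV).symm.trans (hUu.2 V hV))
    exact this ▸ hu
  have hfin : ∀ a b, (limitSeparators R ε a b).Finite := by
    rcases eq_or_forall_of_isPreprimitive hprim (limitSeparators_finite_equivalence R ε)
      (IsInvariantRel.of_imp fun g hg a b h => by
        rw [← image_limitSeparators hG ε hg]; exact h.image g) with h | h
    · exact absurd (h x y hfin₀) hxy
    · exact h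
  obtain ⟨U₀, hU₀, hs₀⟩ := hsep x y hxy
  obtain ⟨u₀, -, hlim₀⟩ := hlim U₀ hU₀ hs₀
  have hall : ∀ z, ∃ U, IsTypedLimit R ε U z := by
    intro z
    obtain ⟨g, hg⟩ := hprim.exists_smul_eq u₀ z
    have : (g : Equiv.Perm X) u₀ = z := hg
    exact ⟨_, this ▸ hlim₀.map (hG g g.2)⟩
  choose L hL using hall
  -- By pigeonhole some two points agree on whether their limit sets are empty. Both cannot be
  -- empty, as `V` below distinguishes them; this provides `u` and `u'`.
  obtain ⟨z, z', hzz, hiff⟩ : ∃ z z', z ≠ z' ∧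
      ((relLimit R (L z)).Nonempty ↔ (relLimit R (L z')).Nonempty) := by
    obtain ⟨z, z', hne, he⟩ :=
      Finite.exists_ne_map_eq_of_infinite fun z => (relLimit R (L z)).Nonempty
    exact ⟨z, z', hne, iff_of_eq he⟩
  obtain ⟨V, hV, hVs⟩ := hsep z z' hzz
  rw [← (hL z).2 V hV, ← (hL z').2 V hV] at hVs
  have hne : (relLimit R (L z)).Nonempty ∧ (relLimit R (L z')).Nonempty := by
    by_contra hn
    have h1 : ¬ (relLimit R (L z)).Nonempty := fun h => hn ⟨h, hiff.1 h⟩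
    have h2 : ¬ (relLimit R (L z')).Nonempty := fun h => hn ⟨hiff.2 h, h⟩
    rw [Set.not_nonempty_iff_eq_empty] at h1 h2
    rw [h1, h2] at hVs
    exact hVs Iff.rfl
  obtain ⟨⟨u, hu⟩, u', hu'⟩ := hne
  have f1 := harc.finite_of_limitSeparators_finite hG hfin hL (hL z).1 hu
  have f2 := harc.finite_of_limitSeparators_finite hG hfin hL (hL z').1 hu'
  have f3 : {w | ¬ (u ∈ relLimit R (L w) ↔ u' ∈ relLimit R (L w))}.Finite :=
    (hfin u u').subset fun w hw => ⟨L w, hL w, hw⟩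
  -- For `V`-almost all `w`, membership in the limit of `L z` amounts to `u` being in the limit of
  -- `L w`, hence to `u'` being there, hence to `w` being in the limit of `L z'`. So `V` could not
  -- tell the two limit sets apart.
  have hev : ∀ᶠ w in V, w ∉ {w | ¬ (u ∈ relLimit R (L w) ↔ w ∈ relLimit R (L z))} ∪
      {w | ¬ (u' ∈ relLimit R (L w) ↔ w ∈ relLimit R (L z'))} ∪
      {w | ¬ (u ∈ relLimit R (L w) ↔ u' ∈ relLimit R (L w))} :=
    hV.1 (((f1.union f2).union f3).subset fun w hw => not_not.1 fun h => hw h)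
  obtain ⟨w, ⟨hw, hwz⟩, hwz'⟩ := ((hev.and (V.eventually_mem_iff _)).and
    (V.eventually_mem_iff _)).exists
  rw [Set.mem_union, Set.mem_union, not_or, not_or] at hw
  have e1 := not_not.1 hw.1.1
  have e2 := not_not.1 hw.1.2
  have e3 := not_not.1 hw.2
  exact hVs (hwz.symm.trans (e1.symm.trans (e3.trans (e2.trans hwz'))))

/-! ### Block sequences -/

/-- The adjacency between the blocks `i` and `j` of a sequence of blocks, each of which is generic
over its predecessors. -/
def blockAdj {X : Type*} (R : X → X → Prop) (U : ℕ → Ultrafilter X) (i j : ℕ) : Prop :=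
  if i < j then relLimit R (U j) ∈ U i else relLimit R (U i) ∈ U j

/-- Disjoint blocks of doubling sizes, homogeneous over `F` and over each other. -/
structure IsBlockSequence {X : Type*} (R : X → X → Prop) (ε : Prop) (F : Finset X)
    (U : ℕ → Ultrafilter X) (k : ℕ) (B : ℕ → Finset X) : Prop where
  card_eq : ∀ i < k, (B i).card = 2 ^ (i + 1)
  notMem : ∀ i < k, ∀ b ∈ B i, b ∉ F
  disjoint : ∀ i < k, ∀ j < k, i ≠ j → Disjoint (B i) (B j)
  rel_left : ∀ i < k, ∀ x ∈ F, ∀ b ∈ B i, R x b ↔ x ∈ relLimit R (U i)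
  rel_self : ∀ i < k, ∀ b ∈ B i, ∀ c ∈ B i, b ≠ c → (R b c ↔ ε)
  rel_block : ∀ i < k, ∀ j < k, i ≠ j → ∀ b ∈ B i, ∀ c ∈ B j, R b c ↔ blockAdj R U i j

/-- Each new block is a piece of a generic sequence over `F` and the earlier blocks. The finite
family `Q` contains all the limit sets in advance, so the points of an earlier block already agree
on membership in the limits of later ultrafilters; this makes adjacency between blocks constant. -/
theorem exists_isBlockSequence {X : Type*} {R : X → X → Prop} (hsymm : ∀ x y, R x y → R y x)
    {ε : Prop} (F : Finset X) {Q : Set (Set X)} (hQ : Q.Finite) {U : ℕ → Ultrafilter X} (k : ℕ)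
    (hU : ∀ i < k, IsTyped R ε (U i)) (hUQ : ∀ i < k, relLimit R (U i) ∈ Q) :
    ∃ B, IsBlockSequence R ε F U k B ∧ ∀ i < k, ∀ b ∈ B i, ∀ q ∈ Q, b ∈ q ↔ q ∈ U i := by
  classical
  have hs : ∀ x y, R x y ↔ R y x := fun x y => ⟨hsymm x y, hsymm y x⟩
  induction k with
  | zero => exact ⟨fun _ => ∅, by constructor <;> simp, by simp⟩
  | succ k ih =>
    obtain ⟨B, hB, hBQ⟩ := ih (fun i hi => hU i (by omega)) (fun i hi => hUQ i (by omega))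
    have hUk := hU k (Nat.lt_succ_self k)
    obtain ⟨b, hinj, hbA, hbR, hbQ, hbb⟩ :=
      exists_generic_seq R hUk.1 (F ∪ (Finset.range k).biUnion B) hQ
    have hbF : ∀ t, b t ∉ F := fun t h => hbA t (Finset.mem_union_left _ h)
    have memU : ∀ i < k, ∀ x ∈ B i, x ∈ F ∪ (Finset.range k).biUnion B := fun i hi x hx =>
      Finset.mem_union_right _ (Finset.mem_biUnion.2 ⟨i, Finset.mem_range.2 hi, hx⟩)
    have hne : ∀ i < k, i ≠ k := fun i hi => hi.ne
    set C := (Finset.range (2 ^ (k + 1))).image b with hC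
    have hdis : ∀ i < k, Disjoint (B i) C := by
      intro i hi
      rw [Finset.disjoint_left]
      intro x hx hxC
      obtain ⟨t, -, rfl⟩ := Finset.mem_image.1 hxC
      exact hbA t (memU i hi _ hx)
    have hBC : ∀ i < k, ∀ x ∈ B i, ∀ c ∈ C, R x c ↔ relLimit R (U k) ∈ U i := by
      intro i hi x hx c hc
      obtain ⟨t, -, rfl⟩ := Finset.mem_image.1 hc
      rw [hbR x (memU i hi x hx), hBQ i hi x hx _ (hUQ k (Nat.lt_succ_self k))]
    have cases : ∀ i < k + 1, i < k ∨ i = k := fun i hi => by omega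
    refine ⟨Function.update B k C, ⟨?_, ?_, ?_, ?_, ?_, ?_⟩, ?_⟩
    · intro i hi
      rcases cases i hi with h | rfl
      · rw [Function.update_of_ne (hne i h)]
        exact hB.card_eq i h
      · rw [Function.update_self, hC, Finset.card_image_of_injective _ hinj, Finset.card_range]
    · intro i hi
      rcases cases i hi with h | rfl
      · rw [Function.update_of_ne (hne i h)]
        exact hB.notMem i h
      · rw [Function.update_self]
        intro c hc
        obtain ⟨t, -, rfl⟩ := Finset.mem_image.1 hc
        exact hbF t
    · intro i hi j hj hij
      rcases cases i hi with h | rfl <;> rcases cases j hj with h' | rfl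
      · rw [Function.update_of_ne (hne i h), Function.update_of_ne (hne j h')]
        exact hB.disjoint i h j h' hij
      · rw [Function.update_of_ne (hne i h), Function.update_self]
        exact hdis i h
      · rw [Function.update_of_ne (hne j h'), Function.update_self]
        exact (hdis j h').symm
      · exact absurd rfl hij
    · intro i hi
      rcases cases i hi with h | rfl
      · rw [Function.update_of_ne (hne i h)]
        exact hB.rel_left i h
      · rw [Function.update_self]
        intro x hx c hc
        obtain ⟨t, -, rfl⟩ := Finset.mem_image.1 hc
        exact hbR x (Finset.mem_union_left _ hx) t
    · intro i hi
      rcases cases i hi with h | rfl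
      · rw [Function.update_of_ne (hne i h)]
        exact hB.rel_self i h
      · rw [Function.update_self]
        intro c hc d hd hcd
        obtain ⟨s, -, rfl⟩ := Finset.mem_image.1 hc
        obtain ⟨t, -, rfl⟩ := Finset.mem_image.1 hd
        rw [← hUk.2]
        rcases lt_trichotomy s t with h | h | h
        · exact hbb s t h
        · exact absurd (h ▸ rfl) hcd
        · rw [hs]
          exact hbb t s h
    · intro i hi j hj hij
      rcases cases i hi with h | rfl <;> rcases cases j hj with h' | rfl
      · rw [Function.update_of_ne (hne i h), Function.update_of_ne (hne j h')]
        exact hB.rel_block i h j h' hij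
      · rw [Function.update_of_ne (hne i h), Function.update_self, blockAdj, if_pos h]
        exact hBC i h
      · rw [Function.update_of_ne (hne j h'), Function.update_self, blockAdj, if_neg (by omega)]
        intro c hc x hx
        rw [hs]
        exact hBC j h' x hx c hc
      · exact absurd rfl hij
    · intro i hi
      rcases cases i hi with h | rfl
      · rw [Function.update_of_ne (hne i h)]
        exact hBQ i h
      · rw [Function.update_self]
        intro c hc q hq
        obtain ⟨t, -, rfl⟩ := Finset.mem_image.1 hc
        exact hbQ q hq t

/-- Over `F`, over its own block and over the other blocks, the point `x` of `F` looks like the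
members of the block `i`. -/
def LooksLikeBlock {X : Type*} (R : X → X → Prop) (ε : Prop) (F : Finset X)
    (U : ℕ → Ultrafilter X) (k : ℕ) (x : X) (i : ℕ) : Prop :=
  (x ∈ relLimit R (U i) ↔ ε) ∧ (∀ y ∈ F, y ≠ x → (R x y ↔ y ∈ relLimit R (U i))) ∧
    ∀ j < k, j ≠ i → (x ∈ relLimit R (U j) ↔ blockAdj R U i j)

/-- Two points which no third point of `A` distinguishes. -/
def IsTwin {X : Type*} (R : X → X → Prop) (A : Finset X) (a b : X) : Prop :=
  ∀ c ∈ A, c ≠ a → c ≠ b → (R a c ↔ R b c)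

theorem IsTwin.apply {X : Type*} {R : X → X → Prop} {A : Finset X} {g : Equiv.Perm X}
    (hg : ∀ x y, R (g x) (g y) ↔ R x y) (hgA : ∀ x, g x ∈ A ↔ x ∈ A) {a b : X}
    (h : IsTwin R A a b) : IsTwin R A (g a) (g b) := by
  intro c hc ha hb
  obtain ⟨c, rfl⟩ := g.surjective c
  rw [hg, hg]
  exact h c ((hgA c).1 hc) (fun e => ha (e ▸ rfl)) (fun e => hb (e ▸ rfl))

theorem IsTwin.of_apply {X : Type*} {R : X → X → Prop} {A : Finset X} {g : Equiv.Perm X}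
    (hg : ∀ x y, R (g x) (g y) ↔ R x y) (hgA : ∀ x, g x ∈ A ↔ x ∈ A) {a b : X}
    (h : IsTwin R A (g a) (g b)) : IsTwin R A a b := by
  intro c hc ha hb
  rw [← hg, ← hg b]
  exact h (g c) ((hgA c).2 hc) (fun e => ha (g.injective e)) (fun e => hb (g.injective e))

/-- Members of a block are twins of one another, while points of `F` have no twins: two of them are
separated by a block, and a twin in a block is excluded by `hlook`. So `g` preserves the union of
the blocks. The number of neighbours of `x` in it is a sum of distinct powers of two, which
determines the blocks adjacent to `x` and thereby `x`. Sizes start at 2, not 1, so that every block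
member has a twin. -/
theorem IsBlockSequence.fixed {X : Type*} [DecidableEq X] {R : X → X → Prop}
    (hsymm : ∀ x y, R x y → R y x) {ε : Prop} {F : Finset X} {U : ℕ → Ultrafilter X} {k : ℕ}
    {B : ℕ → Finset X} (hB : IsBlockSequence R ε F U k B)
    (hsep : ∀ x ∈ F, ∀ y ∈ F, (∀ i < k, x ∈ relLimit R (U i) ↔ y ∈ relLimit R (U i)) → x = y)
    (hlook : ∀ x ∈ F, ∀ i < k, ¬ LooksLikeBlock R ε F U k x i) {g : Equiv.Perm X}
    (hg : ∀ x y, R (g x) (g y) ↔ R x y)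
    (hgA : ∀ x, g x ∈ F ∪ (Finset.range k).biUnion B ↔ x ∈ F ∪ (Finset.range k).biUnion B) :
    ∀ x ∈ F, g x = x := by
  classical
  set T := (Finset.range k).biUnion B with hT
  have memT : ∀ {x}, x ∈ T ↔ ∃ i < k, x ∈ B i := by
    intro x
    rw [hT, Finset.mem_biUnion]
    simp
  have memA : ∀ i < k, ∀ b ∈ B i, b ∈ F ∪ T := fun i hi b hb =>
    Finset.mem_union_right _ (memT.2 ⟨i, hi, hb⟩)
  have hTF : ∀ x ∈ T, x ∉ F := fun x hx => by
    obtain ⟨i, hi, hxi⟩ := memT.1 hx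
    exact hB.notMem i hi x hxi
  have hone : ∀ i < k, 1 < (B i).card := fun i hi => by
    rw [hB.card_eq i hi]
    exact Nat.one_lt_two_pow (Nat.succ_ne_zero i)
  have htwinT : ∀ x ∈ T, ∃ y ∈ F ∪ T, y ≠ x ∧ IsTwin R (F ∪ T) x y := by
    intro x hx
    obtain ⟨i, hi, hxi⟩ := memT.1 hx
    obtain ⟨y, hy, hyx⟩ := Finset.exists_mem_ne (hone i hi) x
    refine ⟨y, memA i hi y hy, hyx, fun c hc hcx hcy => ?_⟩
    rcases Finset.mem_union.1 hc with hcF | hcT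
    · have e1 := hB.rel_left i hi c hcF x hxi
      have e2 := hB.rel_left i hi c hcF y hy
      exact ⟨fun h => hsymm _ _ (e2.2 (e1.1 (hsymm _ _ h))),
        fun h => hsymm _ _ (e1.2 (e2.1 (hsymm _ _ h)))⟩
    · obtain ⟨j, hj, hcj⟩ := memT.1 hcT
      by_cases hij : i = j
      · subst hij
        rw [hB.rel_self i hi x hxi c hcj hcx.symm, hB.rel_self i hi y hy c hcj hcy.symm]
      · rw [hB.rel_block i hi j hj hij x hxi c hcj, hB.rel_block i hi j hj hij y hy c hcj]
  have htwinF : ∀ x ∈ F, ∀ y ∈ F ∪ T, y ≠ x → ¬ IsTwin R (F ∪ T) x y := by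
    intro x hx y hy hyx htw
    have hxB : ∀ i < k, ∀ b ∈ B i, b ≠ x := fun i hi b hb e => hB.notMem i hi b hb (e ▸ hx)
    rcases Finset.mem_union.1 hy with hyF | hyT
    · refine hyx (hsep x hx y hyF fun i hi => ?_).symm
      obtain ⟨c, hc⟩ := Finset.card_pos.1 (zero_lt_one.trans (hone i hi))
      rw [← hB.rel_left i hi x hx c hc, ← hB.rel_left i hi y hyF c hc]
      exact htw c (memA i hi c hc) (hxB i hi c hc) fun e => hB.notMem i hi c hc (e ▸ hyF)
    · obtain ⟨i, hi, hyi⟩ := memT.1 hyT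
      refine hlook x hx i hi ⟨?_, fun z hz hzx => ?_, fun j hj hji => ?_⟩
      · obtain ⟨c, hc, hcy⟩ := Finset.exists_mem_ne (hone i hi) y
        rw [← hB.rel_left i hi x hx c hc, ← hB.rel_self i hi y hyi c hc hcy.symm]
        exact htw c (memA i hi c hc) (hxB i hi c hc) hcy
      · rw [htw z (Finset.mem_union_left _ hz) hzx fun e => hB.notMem i hi y hyi (e ▸ hz),
          ← hB.rel_left i hi z hz y hyi]
        exact ⟨hsymm _ _, hsymm _ _⟩
      · obtain ⟨c, hc⟩ := Finset.card_pos.1 (zero_lt_one.trans (hone j hj))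
        rw [← hB.rel_left j hj x hx c hc, ← hB.rel_block i hi j hj hji.symm y hyi c hc]
        exact htw c (memA j hj c hc) (hxB j hj c hc) fun e =>
          Finset.disjoint_left.1 (hB.disjoint j hj i hi hji) hc (e ▸ hyi)
  have hgT : ∀ x, g x ∈ T ↔ x ∈ T := by
    intro x
    constructor
    · intro hx
      refine (Finset.mem_union.1 ((hgA x).1 (Finset.mem_union_right _ hx))).resolve_left
        fun hxF => ?_
      obtain ⟨y, hy, hyx, htw⟩ := htwinT _ hx
      obtain ⟨y, rfl⟩ := g.surjective y
      exact htwinF x hxF y ((hgA y).1 hy) (fun e => hyx (e ▸ rfl)) (htw.of_apply hg hgA)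
    · intro hx
      refine (Finset.mem_union.1 ((hgA x).2 (Finset.mem_union_right _ hx))).resolve_left
        fun hxF => ?_
      obtain ⟨y, hy, hyx, htw⟩ := htwinT _ hx
      exact htwinF _ hxF _ ((hgA y).2 hy) (fun e => hyx (g.injective e)) (htw.apply hg hgA)
  have hgF : ∀ x ∈ F, g x ∈ F := fun x hx =>
    (Finset.mem_union.1 ((hgA x).2 (Finset.mem_union_left _ hx))).resolve_right fun h =>
      hTF x ((hgT x).1 h) hx
  let S : X → Finset ℕ := fun x => (Finset.range k).filter fun i => x ∈ relLimit R (U i)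
  have hcount : ∀ x ∈ F, (T.filter (R x)).card = ∑ i ∈ S x, 2 ^ (i + 1) := by
    intro x hx
    have : T.filter (R x) = (S x).biUnion B := by
      ext c
      simp only [S, Finset.mem_filter, Finset.mem_biUnion, Finset.mem_range, memT]
      constructor
      · rintro ⟨⟨i, hi, hci⟩, hxc⟩
        exact ⟨i, ⟨hi, (hB.rel_left i hi x hx c hci).1 hxc⟩, hci⟩
      · rintro ⟨i, ⟨hi, hxi⟩, hci⟩
        exact ⟨⟨i, hi, hci⟩, (hB.rel_left i hi x hx c hci).2 hxi⟩
    have hlt : ∀ i ∈ S x, i < k := fun i hi => Finset.mem_range.1 (Finset.mem_filter.1 hi).1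
    rw [this, Finset.card_biUnion fun i hi j hj hij => hB.disjoint i (hlt i hi) j (hlt j hj) hij]
    exact Finset.sum_congr rfl fun i hi => hB.card_eq i (hlt i hi)
  intro x hx
  have hcard : (T.filter (R x)).card = (T.filter (R (g x))).card := by
    refine Finset.card_bij (fun z _ => g z) ?_ (fun _ _ _ _ h => g.injective h) ?_
    · intro z hz
      rw [Finset.mem_filter] at hz ⊢
      exact ⟨(hgT z).2 hz.1, (hg x z).2 hz.2⟩
    · intro z hz
      rw [Finset.mem_filter] at hz
      obtain ⟨z, rfl⟩ := g.surjective z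
      exact ⟨z, Finset.mem_filter.2 ⟨(hgT z).1 hz.1, (hg x z).1 hz.2⟩, rfl⟩
  rw [hcount x hx, hcount _ (hgF x hx)] at hcard
  simp only [pow_succ, ← Finset.sum_mul] at hcard
  have hS : S x = S (g x) := Finset.geomSum_injective le_rfl
    (Nat.eq_of_mul_eq_mul_right two_pos hcard)
  refine (hsep x hx _ (hgF x hx) fun i hi => ?_).symm
  have := Finset.ext_iff.1 hS i
  simpa [S, hi] using this

theorem IsBlockSequence.card_union {X : Type*} [DecidableEq X] {R : X → X → Prop} {ε : Prop}
    {F : Finset X} {U : ℕ → Ultrafilter X} {k : ℕ} {B : ℕ → Finset X}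
    (hB : IsBlockSequence R ε F U k B) :
    (F ∪ (Finset.range k).biUnion B).card + 2 ≤ F.card + 2 ^ (k + 1) := by
  have h1 := Finset.card_union_le F ((Finset.range k).biUnion B)
  have h2 : ((Finset.range k).biUnion B).card ≤ ∑ i ∈ Finset.range k, 2 ^ (i + 1) :=
    Finset.card_biUnion_le.trans
      (Finset.sum_le_sum fun i hi => (hB.card_eq i (Finset.mem_range.1 hi)).le)
  have h3 : ∑ i ∈ Finset.range k, 2 ^ (i + 1) + 2 = 2 ^ (k + 1) := by
    clear hB h1 h2
    induction k with
    | zero => rfl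
    | succ k ih =>
      rw [Finset.sum_range_succ, pow_succ 2 (k + 1)]
      omega
  omega

theorem exists_seq_of_append {α : Type*} [Nonempty α] (l₁ l₂ : List α) :
    ∃ f : ℕ → α, (∀ i < l₁.length, f i ∈ l₁) ∧
      (∀ i, l₁.length ≤ i → i < l₁.length + l₂.length → f i ∈ l₂) ∧
      (∀ a ∈ l₁, ∃ i < l₁.length, f i = a) ∧
      ∀ a ∈ l₂, ∃ i, l₁.length ≤ i ∧ i < l₁.length + l₂.length ∧ f i = a := by
  -- The default `d` is taken only beyond the end of the concatenated list, where nothing is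
  -- claimed.
  obtain ⟨d⟩ := ‹Nonempty α›
  have h1 : ∀ i (hi : i < l₁.length), (l₁ ++ l₂).getD i d = l₁[i] := by
    intro i hi
    rw [List.getD_eq_getElem _ _ (by rw [List.length_append]; omega), List.getElem_append_left hi]
  have h2 : ∀ i (hi : i < l₂.length), (l₁ ++ l₂).getD (l₁.length + i) d = l₂[i] := by
    intro i hi
    rw [List.getD_eq_getElem _ _ (by rw [List.length_append]; omega),
      List.getElem_append_right (by omega)]
    simp
  refine ⟨fun i => (l₁ ++ l₂).getD i d, ?_, ?_, ?_, ?_⟩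
  · intro i hi
    beta_reduce
    rw [h1 i hi]
    exact List.getElem_mem _
  · intro i hi hi'
    obtain ⟨j, rfl⟩ := Nat.exists_eq_add_of_le hi
    beta_reduce
    rw [h2 j (by omega)]
    exact List.getElem_mem _
  · intro a ha
    obtain ⟨i, hi, rfl⟩ := List.getElem_of_mem ha
    exact ⟨i, hi, h1 i hi⟩
  · intro a ha
    obtain ⟨i, hi, rfl⟩ := List.getElem_of_mem ha
    exact ⟨l₁.length + i, by omega, by omega, h2 i hi⟩

/-- Separating ultrafilters `U` that are limits of no point of `F` are used, each with auxiliary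
ultrafilters `V U u` witnessing that `U` does not look like `u`. The blocks of the auxiliary ones
keep points of `F` from resembling a block. -/
theorem exists_isRigidExtension_of_typed {X : Type*} [Infinite X] {G : Subgroup (Equiv.Perm X)}
    (hprim : MulAction.IsPreprimitive G X) {R : X → X → Prop} (hG : IsInvariantRel G R)
    (harc : IsArcTransitive G R) (hsymm : ∀ x y, R x y → R y x) {ε : Prop}
    (hsep : ∀ x y, x ≠ y → ∃ U, IsTyped R ε U ∧ ¬ (x ∈ relLimit R U ↔ y ∈ relLimit R U))
    (F : Finset X) : ∃ A, IsRigidExtension G F A := by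
  classical
  rcases le_or_gt F.card 1 with hF | hF
  · exact exists_isRigidExtension_of_card_le_one G hF
  obtain ⟨L, hlen, hsplit, hL⟩ := exists_separating_list
    (ι := {U : Ultrafilter X // IsTyped R ε U ∧
      ∀ u ∈ F, ∃ V, IsTyped R ε V ∧ ¬ (relLimit R U ∈ V ↔ u ∈ relLimit R V)})
    (fun U => relLimit_equivalence R U.1)
    (fun x y hxy => by
      obtain ⟨U, hU, hs, hV⟩ := exists_separating_not_limit hprim hG harc hsep F hxy
      exact ⟨⟨U, hU, hV⟩, hs⟩) F
  have hV : ∀ (U : {U : Ultrafilter X // IsTyped R ε U ∧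
      ∀ u ∈ F, ∃ V, IsTyped R ε V ∧ ¬ (relLimit R U ∈ V ↔ u ∈ relLimit R V)}) (u : X),
      ∃ V, u ∈ F → IsTyped R ε V ∧ ¬ (relLimit R U.1 ∈ V ↔ u ∈ relLimit R V) := by
    intro U u
    by_cases hu : u ∈ F
    · obtain ⟨V, hV⟩ := U.2.2 u hu
      exact ⟨V, fun _ => hV⟩
    -- A dummy value: `V U u` matters only for `u` in `F`.
    · exact ⟨U.1, fun h => absurd h hu⟩
  choose V hV using hV
  -- Only these points can resemble a block of `U`, so only they need a witness. As `U` splits `F`,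
  -- they are not all of `F`, whence at most `(|F| - 1) ^ 2` witnesses and `|F| ^ 2 - |F|` blocks in
  -- all.
  let C : Ultrafilter X → Finset X := fun U => F.filter fun u =>
    (u ∈ relLimit R U ↔ ε) ∧ ∀ y ∈ F, y ≠ u → (R u y ↔ y ∈ relLimit R U)
  have hC : ∀ U ∈ L, (C U.1).card ≤ F.card - 1 := by
    intro U hU
    obtain ⟨x, hx, y, hy, hxy⟩ := hsplit U hU
    have hlt : C U.1 ⊂ F := by
      refine (Finset.filter_subset _ _).ssubset_of_ne fun e => hxy ?_
      rw [Finset.filter_eq_self] at e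
      exact (e x hx).1.trans (e y hy).1.symm
    have := Finset.card_lt_card hlt
    omega
  set l₁ := L.flatMap fun U => (C U.1).toList.map (V U) with hl₁
  set l₂ := L.map Subtype.val with hl₂
  have hl₁len : l₁.length ≤ L.length * (F.card - 1) := by
    rw [hl₁, List.length_flatMap]
    refine (List.sum_le_card_nsmul _ (F.card - 1) ?_).trans ?_
    · intro m hm
      obtain ⟨U, hU, rfl⟩ := List.mem_map.1 hm
      simpa using hC U hU
    · simp
  have mem₁ : ∀ {W}, W ∈ l₁ ↔ ∃ U ∈ L, ∃ u ∈ C U.1, V U u = W := by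
    intro W
    simp [hl₁]
  have mem₂ : ∀ {W}, W ∈ l₂ ↔ ∃ U ∈ L, U.1 = W := by
    intro W
    rw [hl₂, List.mem_map]
  have hCF : ∀ {U u}, u ∈ C U → u ∈ F := fun h => (Finset.mem_filter.1 h).1
  obtain ⟨x₀⟩ : Nonempty X := inferInstance
  have : Nonempty (Ultrafilter X) := ⟨pure x₀⟩
  -- The witnesses come first, so that the adjacency between the blocks of `V` and `U` is `relLimit
  -- R U ∈ V`, the statement on which `V` was chosen.
  obtain ⟨f, f1, f2, f3, f4⟩ := exists_seq_of_append l₁ l₂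
  set k := l₁.length + l₂.length with hk
  have htyped : ∀ i < k, IsTyped R ε (f i) := by
    intro i hi
    rcases lt_or_ge i l₁.length with h | h
    · obtain ⟨U, hU, u, hu, e⟩ := mem₁.1 (f1 i h)
      exact e ▸ (hV U u (hCF hu)).1
    · obtain ⟨U, hU, e⟩ := mem₂.1 (f2 i h hi)
      exact e ▸ U.2.1
  obtain ⟨B, hB, -⟩ := exists_isBlockSequence hsymm F
    (Q := (fun i => relLimit R (f i)) '' Set.Iio k) ((Set.finite_Iio k).image _) k htyped
    (fun i hi => ⟨i, hi, rfl⟩)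
  refine ⟨F ∪ (Finset.range k).biUnion B, Finset.subset_union_left, ?_, fun g hg hgA =>
    hB.fixed hsymm ?_ ?_ (hG g hg) hgA⟩
  · refine hB.card_union.trans (Nat.add_le_add_left (Nat.pow_le_pow_right two_pos ?_) _)
    have hl₂len : l₂.length = L.length := List.length_map _
    have e1 : F.card ^ 2 - F.card = (F.card - 1) * (F.card - 1) + (F.card - 1) := by
      obtain ⟨m, hm⟩ : ∃ m, F.card = m + 1 := ⟨F.card - 1, by omega⟩
      rw [hm, Nat.add_sub_cancel]
      have : (m + 1) ^ 2 = m * m + m + (m + 1) := by ring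
      omega
    have e2 := Nat.mul_le_mul_right (F.card - 1) hlen
    omega
  · intro x hx y hy hxy
    refine hL x hx y hy fun U hU => ?_
    obtain ⟨i, -, hi, e⟩ := f4 U.1 (mem₂.2 ⟨U, hU, rfl⟩)
    rw [← e]
    exact hxy i hi
  · rintro x hx i hi ⟨hself, hF', hblock⟩
    rcases lt_or_ge i l₁.length with h | h
    · obtain ⟨U, hU, u, hu, e⟩ := mem₁.1 (f1 i h)
      obtain ⟨j, hj, hjk, ej⟩ := f4 U.1 (mem₂.2 ⟨U, hU, rfl⟩)
      have hVU := (hV U u (hCF hu)).2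
      have hb := hblock j hjk (by omega)
      rw [blockAdj, if_pos (by omega), ej, ← e] at hb
      rw [← e] at hself hF'
      obtain ⟨huF, hue, huy⟩ := Finset.mem_filter.1 hu
      by_cases hxu : x = u
      · subst hxu
        -- A point `x` resembling the block of `V U u` would make `V` agree with `u` about `U`:
        -- through `ε` if `x = u`, and otherwise through the symmetry of `R` between `x` and `u`.
        exact hVU (hb.symm.trans (hue.trans hself.symm))
      · have h1 := hF' u huF (Ne.symm hxu)
        have h2 := huy x hx hxu
        have h3 : R x u ↔ R u x := ⟨hsymm _ _, hsymm _ _⟩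
        exact hVU (hb.symm.trans (h2.symm.trans (h3.symm.trans h1)))
    · obtain ⟨U, hU, e⟩ := mem₂.1 (f2 i h hi)
      have hxC : x ∈ C U.1 := by
        rw [e]
        exact Finset.mem_filter.2 ⟨hx, hself, hF'⟩
      obtain ⟨j, hj, ej⟩ := f3 (V U x) (mem₁.2 ⟨U, hU, x, hxC, rfl⟩)
      have hb := hblock j (by omega) (by omega)
      rw [blockAdj, if_neg (by omega), ej, ← e] at hb
      exact (hV U x hx).2 hb.symm

/-! ### Graphs and the final case distinction -/

/-- The case of a nonempty invariant graph with finite neighbourhoods. -/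
theorem exists_isRigidExtension_of_finite {X : Type*} [Infinite X] {G : Subgroup (Equiv.Perm X)}
    (hprim : MulAction.IsPreprimitive G X) {R : X → X → Prop} (hG : IsInvariantRel G R)
    (hsymm : ∀ x y, R x y → R y x) (hirr : ∀ x, ¬ R x x) {a b : X} (hab : R a b) {u : X}
    (hfin : {y | R u y}.Finite) (F : Finset X) : ∃ A, IsRigidExtension G F A := by
  let Γ : SimpleGraph X := ⟨R, ⟨hsymm⟩, ⟨hirr⟩⟩
  have hadj : ∀ x y, Γ.Adj x y ↔ R x y := fun _ _ => Iff.rfl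
  have hreach : ∀ g ∈ G, ∀ x y, Γ.Reachable x y → Γ.Reachable (g x) (g y) := by
    rintro g hg x y ⟨p⟩
    let φ : Γ →g Γ := ⟨g, fun {a b} h => (hG g hg a b).2 h⟩
    exact ⟨p.map φ⟩
  have hconn : Γ.Connected := by
    have : Nonempty X := ⟨a⟩
    refine ⟨?_⟩
    rcases eq_or_forall_of_isPreprimitive hprim Γ.reachable_is_equivalence
      (IsInvariantRel.of_imp hreach) with h | h
    · have e := h a b (SimpleGraph.Adj.reachable ((hadj a b).2 hab))
      exact absurd (e ▸ hab) (hirr b)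
    · exact h
  refine SimpleGraph.exists_isRigidExtension_of_finite hprim hconn (fun x => ?_) hG F
  obtain ⟨g, hg⟩ := hprim.exists_smul_eq u x
  have hg' : (g : Equiv.Perm X) u = x := hg
  refine (hfin.image g).subset fun y hy => ?_
  obtain ⟨z, rfl⟩ := (g : Equiv.Perm X).surjective y
  refine ⟨z, ?_, rfl⟩
  rw [← hg'] at hy
  exact (hG g g.2 u z).1 hy

/-- Each type of ultrafilter separates all pairs or none. If both types fail, no nonprincipal
ultrafilter contains a difference set, so all of these are finite. Counting along arcs then forces
finite neighbourhoods in the graph or in its complement. -/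
theorem exists_isRigidExtension_of_graph {X : Type*} [Infinite X] {G : Subgroup (Equiv.Perm X)}
    (hprim : MulAction.IsPreprimitive G X) {R : X → X → Prop} (hG : IsInvariantRel G R)
    (harc : IsArcTransitive G R) (hsymm : ∀ x y, R x y → R y x) (hirr : ∀ x, ¬ R x x)
    {a b c d : X} (hab : R a b) (hcd : c ≠ d) (hcd' : ¬ R c d) (F : Finset X) :
    ∃ A, IsRigidExtension G F A := by
  have hdich : ∀ ε : Prop,
      (∀ x y, (∀ U, IsTyped R ε U → (x ∈ relLimit R U ↔ y ∈ relLimit R U)) → x = y) ∨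
      ∀ x y, ∀ U, IsTyped R ε U → (x ∈ relLimit R U ↔ y ∈ relLimit R U) := by
    intro ε
    refine eq_or_forall_of_isPreprimitive hprim ⟨fun _ _ _ => Iff.rfl,
      fun h U hU => (h U hU).symm, fun h h' U hU => (h U hU).trans (h' U hU)⟩
      (IsInvariantRel.of_imp fun g hg x y h U hU => ?_)
    have hU' := h _ (hU.map (hG g⁻¹ (G.inv_mem hg)))
    have e : ∀ z, z ∈ relLimit R (U.map (g⁻¹ : Equiv.Perm X)) ↔ g z ∈ relLimit R U := fun z => by
      rw [← apply_mem_relLimit_map (hG g⁻¹ (G.inv_mem hg)) U (g z)]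
      simp
    rwa [e, e] at hU'
  have huse : ∀ ε : Prop,
      (∀ x y, (∀ U, IsTyped R ε U → (x ∈ relLimit R U ↔ y ∈ relLimit R U)) → x = y) →
      ∃ A, IsRigidExtension G F A := by
    intro ε h
    refine exists_isRigidExtension_of_typed hprim hG harc hsymm (ε := ε) (fun x y hxy => ?_) F
    by_contra hno
    refine hxy (h x y fun U hU => ?_)
    by_contra hn
    exact hno ⟨U, hU, hn⟩
  rcases hdich True with h | hT
  · exact huse True h
  rcases hdich False with h | hF
  · exact huse False h
  have hfin : ∀ x y, (diffSet R x y).Finite := by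
    intro x y
    by_contra hinf
    obtain ⟨U, hU, hmem⟩ := exists_ultrafilter_of_infinite hinf
    refine (diffSet_mem_iff R U x y).1 hmem ?_
    by_cases h : relLimit R U ∈ U
    · exact hT x y U ⟨hU, by simpa using h⟩
    · exact hF x y U ⟨hU, by simpa using h⟩
  by_cases hN : {y | R a y}.Finite
  · exact exists_isRigidExtension_of_finite hprim hG hsymm hirr hab hN F
  have hco : {y | ¬ R a y}.Finite := by
    refine harc.not_infinite_of_diffSet_finite hG hfin hN fun z hz y _ _ hzy e => hz ?_
    exact e.mpr (hsymm _ _ hzy)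
  refine exists_isRigidExtension_of_finite hprim (R := fun x y => x ≠ y ∧ ¬ R x y)
    (fun g hg x y => and_congr g.injective.ne_iff (not_congr (hG g hg x y)))
    (fun x y h => ⟨h.1.symm, fun h' => h.2 (hsymm _ _ h')⟩) (fun x h => h.1 rfl)
    ⟨hcd, hcd'⟩ (u := a) (hco.subset fun y hy => hy.2) F

theorem exists_isRigidExtension {X : Type*} [Infinite X] {G : Subgroup (Equiv.Perm X)}
    (hprim : MulAction.IsPreprimitive G X)
    (hnot : ¬ MulAction.IsMultiplyPretransitive G X 2) (F : Finset X) :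
    ∃ A, IsRigidExtension G F A := by
  rw [MulAction.is_two_pretransitive_iff] at hnot
  push Not at hnot
  obtain ⟨a, b, c, d, hab, hcd, hno⟩ := hnot
  have hno' : ∀ g ∈ G, g a = c → g b ≠ d := fun g hg => hno ⟨g, hg⟩
  let P : X → X → X → X → Prop := fun p q x y => ∃ g ∈ G, g p = x ∧ g q = y
  have hP : ∀ p q, IsInvariantRel G (P p q) := fun p q => IsInvariantRel.of_imp
    fun g hg x y ⟨h, hh, e1, e2⟩ => ⟨g * h, G.mul_mem hg hh, by simp [e1], by simp [e2]⟩
  have htrans : ∀ {p q x y x' y'}, P p q x y → P p q x' y' → P x y x' y' := by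
    rintro p q x y x' y' ⟨g, hg, rfl, rfl⟩ ⟨h, hh, rfl, rfl⟩
    exact ⟨h * g⁻¹, G.mul_mem hh (G.inv_mem hg), by simp, by simp⟩
  by_cases hhom : ∀ x y, x ≠ y → P a b x y ∨ P a b y x
  · have hswap : ¬ P a b b a := by
      intro hs
      rcases hhom c d hcd with ⟨g, hg, e1, e2⟩ | ⟨g, hg, e1, e2⟩
      · exact hno' g hg e1 e2
      · obtain ⟨h, hh, e3, e4⟩ := hs
        exact hno' (g * h) (G.mul_mem hg hh) (by simp [e3, e2]) (by simp [e4, e1])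
    have hT : IsTournamentRel (P a b) := by
      refine ⟨fun x y h h' => hswap ?_, hhom⟩
      obtain ⟨g, hg, e1, e2⟩ := htrans h h'
      obtain ⟨k, hk, rfl, rfl⟩ := h
      refine ⟨k⁻¹ * (g * k), G.mul_mem (G.inv_mem hk) (G.mul_mem hg hk), ?_, ?_⟩
      · simp [e1]
      · simp [e2]
    have harc : IsArcTransitive G (P a b) := fun x y x' y' h h' => by
      obtain ⟨g, hg, e⟩ := htrans h h'
      exact ⟨g, hg, Or.inl e⟩
    -- As `X` is infinite, `a` has infinitely many out-neighbours or infinitely many in-neighbours;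
    -- in the second case the tournament is reversed.
    by_cases hN : {y | P a b a y}.Infinite
    · exact hT.exists_isRigidExtension hprim (hP a b) harc hN F
    · refine hT.flip.exists_isRigidExtension hprim (fun g hg x y => hP a b g hg y x)
        (fun x y x' y' h h' => ?_) (u := a) ?_ F
      · obtain ⟨g, hg, e | e⟩ := harc y x y' x' h h'
        · exact ⟨g, hg, Or.inl e.symm⟩
        · exact ⟨g, hg, Or.inr e.symm⟩
      · intro hfin
        refine Set.infinite_univ (α := X) ?_
        refine (((Set.finite_singleton a).union (Set.not_infinite.1 hN)).union hfin).subset ?_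
        intro y _
        by_cases hy : y = a
        · exact Or.inl (Or.inl hy)
        · rcases hhom y a hy with h | h
          · exact Or.inr h
          · exact Or.inl (Or.inr h)
  · push Not at hhom
    obtain ⟨x, y, hxy, h1, h2⟩ := hhom
    refine exists_isRigidExtension_of_graph hprim (R := fun x y => P a b x y ∨ P a b y x)
      (fun g hg x y => or_congr (hP a b g hg x y) (hP a b g hg y x)) ?_
      (fun _ _ h => h.symm) ?_ (a := a) (b := b) (Or.inl ⟨1, G.one_mem, rfl, rfl⟩) hxy
      (fun h => h.elim h1 h2) F
    · intro p q p' q' h h'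
      rcases h with h | h <;> rcases h' with h' | h'
      · obtain ⟨g, hg, e⟩ := htrans h h'
        exact ⟨g, hg, Or.inl e⟩
      · obtain ⟨g, hg, e⟩ := htrans h h'
        exact ⟨g, hg, Or.inr e⟩
      · obtain ⟨g, hg, e⟩ := htrans h h'
        exact ⟨g, hg, Or.inr e.symm⟩
      · obtain ⟨g, hg, e⟩ := htrans h h'
        exact ⟨g, hg, Or.inl e.symm⟩
    · rintro p (⟨g, -, e1, e2⟩ | ⟨g, -, e1, e2⟩)
      · exact hab (g.injective (e1.trans e2.symm))
      · exact hab (g.injective (e1.trans e2.symm))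

theorem theorem4p1 {X : Type*} [Infinite X] [DecidableEq X] (G H : Subgroup (Equiv.Perm X))
    (hGc : IsClosedPermGroup G) (hHc : IsClosedPermGroup H) (hHG : H ≤ G)
    (hprim : MulAction.IsPreprimitive G X)
    (hnot : ¬ MulAction.IsMultiplyPretransitive G X 2)
    (n : ℕ)
    (hsets : ∀ l : ℕ, l ≤ n + 2 ^ (n ^ 2 - n + 2) - 2 →
      HaveSameOrbitsOn G H (Set.powersetCard X l)) :
    ∀ m : ℕ, m ≤ n → HaveSameOrbitsOn G H (Fin m → X) :=
  haveSameOrbitsOn_tuples hHG (exists_isRigidExtension hprim hnot) n hsets
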